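/- Let $n\ge 1$ be real. Consider a finite tree rooted at a single source, whose leaves (other than the source) are the sinks. Each edge $e$, directed away from the source, has a resistance $k_e\ge 0$. The source is held at a constant potential and all sinks at a common, strictly lower potential; on the path from the source to each sink at least one edge has positive resistance. Each terminal edge (edge ending in a sink) carries a valve, whose setting is an additional resistance $r\in[0,\infty]$ ($r=0$: fully open, $r=\infty$: closed, no flow). A continuous valve may take every setting; an ON/OFF valve only $0$ and $\infty$. An equilibrium flow for a given setting of the valves consists of flow rates $Q_e\ge 0$, conserved at every vertex other than the source and the sinks, for which there are potentials at the vertices with the prescribed values at the source and the sinks such that the drop is $\Delta H=kQ^n$ along every edge, where $k=k_e$ on non-terminal edges and $k=k_e+r$ on terminal edges with $r<\infty$, while $Q_e=0$ on closed terminal edges. A schedule runs through finitely many equilibrium flows (each for some setting of the valves), each held for some time $\ge 0$; it delivers the demand $D$ if the total quantity received by each sink $\ell$ is $D_\ell$. Here $D=(D_\ell)$ is nonnegative and not identically zero. Let $t_{d}$ and $t_{cv}$ be the minimal total times of schedules that deliver $D$ with ON/OFF valves and with continuous valves, respectively, let $\mathbf R=t_d/t_{cv}$, and let $m$ be the maximum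 depth of the tree (number of edges on a longest path from the source to a sink). Then both minima exist, $t_{cv}>0$, and $$1\le \mathbf R\le m^{1-1/n}.$$ The bound is tight: for every integer $m\ge 1$, the supremum of $\mathbf R$ over all such networks of maximum depth $m$ with at least two sinks, and over all demands, equals $m^{1-1/n}$. -/

import Mathlib

open scoped ENNReal

noncomputable section

/-- A branched (loop-free) potential-flow network with a single source, on the vertex set `V`.
The tree is given by its parent map: every vertex `v ≠ source` carries exactly one edge
`parent v → v`, and we index that edge by its lower end `v`. -/
structure FlowNetwork (V : Type*) where
  source : V
  parent : V → V
  /-- Convention: the source is its own parent (there is no edge above the source). -/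
  parent_source : parent source = source
  /-- Every vertex is joined to the source, so there are no loops. -/
  reaches_source : ∀ v, ∃ j : ℕ, parent^[j] v = source
  /-- `k v` is the resistance of the edge `parent v → v` (with its valve, if any, fully open). -/
  k : V → ℝ
  k_nonneg : ∀ v, v ≠ source → 0 ≤ k v
  /-- The constant potential at the source. -/
  sourceHead : ℝ
  /-- The common potential of all the sinks. -/
  sinkHead : ℝ
  head_lt : sinkHead < sourceHead
  /-- No sink (vertex without children) is short-circuited to the source: on the way from the
  source to a sink there is an edge of positive resistance. -/
  path_pos : ∀ l, (∀ w, parent w ≠ l) →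
    ∃ j : ℕ, parent^[j] l ≠ source ∧ 0 < k (parent^[j] l)

namespace FlowNetwork

variable {V : Type*} (N : FlowNetwork V)

/-- The sinks (demand nodes) are the leaves of the tree. The source is never one of them, as it
is its own parent. -/
def IsSink (v : V) : Prop := ∀ w, N.parent w ≠ v

/-- The type of sinks. -/
abbrev Sink : Type _ := {v : V // N.IsSink v}

/-- The depth of a vertex: the number of edges between the source and it. -/
def depth (v : V) : ℕ := sInf {j : ℕ | N.parent^[j] v = N.source}

/-- The maximum depth of the tree. -/
def maxDepth [Fintype V] : ℕ := Finset.univ.sup N.depth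

/-- A valve configuration: the additional resistance that the valve puts on each terminal edge;
`0` is fully open and `⊤` is fully closed. -/
abbrev ValveConfig : Type _ := N.Sink → ℝ≥0∞

/-- The configurations available with ON/OFF (discrete) valves. -/
def onOffConfigs : Set N.ValveConfig := {r | ∀ l, r l = 0 ∨ r l = ⊤}

/-- The configurations available with continuous valves. -/
def continuousConfigs : Set N.ValveConfig := Set.univ

open Classical in
/-- `Q` (with `Q v` the flow rate from `parent v` to `v`) is an equilibrium flow of the network
under the valve configuration `r`, when the potential drop along an edge of resistance `k` with
flow rate `Q` is `k * Q ^ n`. Flow runs from the source towards the sinks. -/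
def IsEquilibrium [Fintype V] (n : ℝ) (r : N.ValveConfig) (Q : V → ℝ) : Prop :=
  (∀ v, v ≠ N.source → 0 ≤ Q v) ∧
  (∀ v, v ≠ N.source → ¬ N.IsSink v →
    Q v = ∑ w ∈ Finset.univ.filter (fun w => N.parent w = v), Q w) ∧
  ∃ H : V → ℝ,
    H N.source = N.sourceHead ∧
    (∀ l : N.Sink, H l = N.sinkHead) ∧
    (∀ v, v ≠ N.source → ¬ N.IsSink v → H (N.parent v) - H v = N.k v * Q v ^ n) ∧
    (∀ l : N.Sink, r l = ⊤ → Q l = 0) ∧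
    (∀ l : N.Sink, r l ≠ ⊤ → H (N.parent l) - H l = (N.k l + (r l).toReal) * Q l ^ n)

/-- The total operating times of the schedules that use configurations in `U` and deliver exactly
the demand `D`. A schedule runs through finitely many states, the `i`-th of which is an equilibrium
flow `Q i` under the configuration `r i`, held for the time `t i`. -/
def operatingTimes [Fintype V] (n : ℝ) (U : Set N.ValveConfig) (D : N.Sink → ℝ) : Set ℝ :=
  {T | ∃ (s : ℕ) (r : Fin s → N.ValveConfig) (Q : Fin s → V → ℝ) (t : Fin s → ℝ),
    (∀ i, r i ∈ U ∧ N.IsEquilibrium n (r i) (Q i) ∧ 0 ≤ t i) ∧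
    (∀ l : N.Sink, ∑ i, t i * Q i l = D l) ∧
    ∑ i, t i = T}

/-- The minimal time needed to deliver the demand `D` with configurations in `U`. -/
def minTime [Fintype V] (n : ℝ) (U : Set N.ValveConfig) (D : N.Sink → ℝ) : ℝ :=
  sInf (N.operatingTimes n U D)

/-- The ratio `R` of the minimal time with ON/OFF valves to the minimal time with continuous
valves. -/
def timeRatio [Fintype V] (n : ℝ) (D : N.Sink → ℝ) : ℝ :=
  N.minTime n N.onOffConfigs D / N.minTime n N.continuousConfigs D

/-- A demand: a nonnegative quantity for each sink, not all of them zero. -/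
def IsDemand (D : N.Sink → ℝ) : Prop := (∀ l, 0 ≤ D l) ∧ ∃ l, 0 < D l

end FlowNetwork

end

/-!
After the valve settings are eliminated, a flow is possible with continuous valves when along each
path the terminal edge needs no more than the head left at its parent (`IsFeasible`), and with
ON/OFF valves when moreover every sink either gets no flow or uses all of that head (`IsOnOff`).
The rates at which the sinks can be served form compact sets in both cases, and a demand `D` can
be delivered in time `T` exactly when `D` is `T` times a point of the convex hull of the available
rates (`mem_operatingTimes_iff`). So the minima exist, and the upper bound says that feasible
rates lie in `m ^ (1 - 1 / n)` times the convex hull of the ON/OFF rates, where `m` is the maximum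
depth (`feasibleRates_subset`).

By Hahn-Banach this has a dual form: for all weights `c` of the sinks and every feasible flow `Q`
some ON/OFF flow `q` has `∑ c Q ≤ m ^ (1 - 1 / n) * ∑ c q` (`IsFeasible.exists_isOnOff_of_pos`).
The idea is an induction on the height of the tree. Suppose an edge of resistance `k` is put on
top of a tree of height `m - 1`. An ON/OFF setting that draws the total flow `A` and has the value
`V` in the old tree under a unit head has the value `V / (1 + k * A ^ n) ^ (1 / n)` in the new
one. To make this at least `φ` it is enough that `V - φ * k ^ (1 / n) * A ≥ φ`, because
`(1 + a ^ n) ^ (1 / n) ≤ 1 + a`; this is again a linear objective, in which each unit of flow pays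
a price, and the induction hypothesis applies to it. Since prices only add up from the source
downwards, they can be fixed beforehand, and the sinks to open are those whose weight exceeds
their price. Each level costs an instance of Hölder's inequality,
`(m - 1) ^ (1 - 1 / n) * x ^ (1 / n) + y ^ (1 / n) ≤ m ^ (1 - 1 / n) * (x + y) ^ (1 / n)`
(`rpow_mul_add_rpow_le`), which gives the factor.
Terminal edges without resistance are reached by a limit (`IsFeasible.exists_isOnOff`).

The bound is approached on a path of `m` edges with a short-circuited sink at each inner vertex
and rapidly growing resistances (`caterpillar`). An open short-circuited sink cuts off everything
beyond it, so ON/OFF valves have to serve the sinks one after the other; continuous valves serve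
them simultaneously, and the flow to each sink loses its head essentially on a single edge.
-/

noncomputable section

namespace FlowNetwork

open Classical

/-! ### Recursion along the tree -/

section Tree

variable {V : Type*} (N : FlowNetwork V)

lemma not_isSink_source : ¬ N.IsSink N.source := fun h => h _ N.parent_source

lemma not_isSink_parent (v : V) : ¬ N.IsSink (N.parent v) := fun h => h v rfl

lemma IsSink.ne_source {N : FlowNetwork V} {v : V} (h : N.IsSink v) : v ≠ N.source := by
  rintro rfl
  exact N.not_isSink_source h

lemma ne_source_of_parent_eq {v w : V} (hv : v ≠ N.source) (h : N.parent w = v) :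
    w ≠ N.source := by
  rintro rfl
  exact hv (h ▸ N.parent_source)

lemma depth_source : N.depth N.source = 0 :=
  Nat.sInf_eq_zero.2 (Or.inl rfl)

lemma iterate_depth (v : V) : N.parent^[N.depth v] v = N.source :=
  Nat.sInf_mem (s := {j : ℕ | N.parent^[j] v = N.source}) (N.reaches_source v)

lemma depth_le_of_iterate {v : V} {j : ℕ} (h : N.parent^[j] v = N.source) : N.depth v ≤ j :=
  Nat.sInf_le h

lemma depth_eq_succ {v : V} (hv : v ≠ N.source) : N.depth v = N.depth (N.parent v) + 1 := by
  apply le_antisymm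
  · apply N.depth_le_of_iterate
    rw [Function.iterate_succ_apply]
    exact N.iterate_depth _
  · have h := N.iterate_depth v
    rcases hd : N.depth v with _ | d
    · rw [hd] at h
      exact absurd h hv
    · rw [hd, Function.iterate_succ_apply] at h
      exact Nat.succ_le_succ (N.depth_le_of_iterate h)

lemma parent_induction {P : V → Prop} (h0 : P N.source)
    (h : ∀ v, v ≠ N.source → P (N.parent v) → P v) (v : V) : P v := by
  induction hd : N.depth v using Nat.strong_induction_on generalizing v with
  | _ d ih =>
    by_cases hv : v = N.source
    · exact hv ▸ h0
    · exact h v hv (ih _ (by have := N.depth_eq_succ hv; omega) _ rfl)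

/-- Definition by recursion from the source downwards. -/
lemma exists_rec_parent {α : Type*} (a : α) (f : V → α → α) :
    ∃ g : V → α, g N.source = a ∧ ∀ v, v ≠ N.source → g v = f v (g (N.parent v)) := by
  have wf : WellFounded (fun p v : V => N.parent v = p ∧ v ≠ N.source) :=
    Subrelation.wf (r := InvImage (· < ·) N.depth)
      (by
        rintro p v ⟨rfl, hv⟩
        change N.depth (N.parent v) < N.depth v
        rw [N.depth_eq_succ hv]
        exact Nat.lt_succ_self _)
      (InvImage.wf _ Nat.lt_wfRel.wf)
  refine ⟨wf.fix (fun v ih => if hv : v = N.source then a else f v (ih (N.parent v) ⟨rfl, hv⟩)),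
    ?_, fun v hv => ?_⟩
  · rw [wf.fix_eq, dif_pos rfl]
  · rw [wf.fix_eq, dif_neg hv]

variable [Fintype V]

lemma depth_le_maxDepth (v : V) : N.depth v ≤ N.maxDepth :=
  Finset.le_sup (f := N.depth) (Finset.mem_univ v)

lemma wellFounded_child : WellFounded (fun x v : V => N.parent x = v ∧ x ≠ N.source) := by
  refine Subrelation.wf (r := InvImage (· < ·) (fun v => N.maxDepth - N.depth v)) ?_
    (InvImage.wf _ Nat.lt_wfRel.wf)
  rintro x v ⟨rfl, hx⟩
  have h1 := N.depth_eq_succ hx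
  have h2 := N.depth_le_maxDepth x
  exact (by omega : N.maxDepth - N.depth x < N.maxDepth - N.depth (N.parent x))

lemma child_induction {P : V → Prop}
    (h : ∀ v, (∀ x, N.parent x = v → x ≠ N.source → P x) → P v) (v : V) : P v :=
  N.wellFounded_child.induction v fun v ih => h v fun x hx hx' => ih x ⟨hx, hx'⟩

/-- Definition by recursion from the sinks upwards, for a step that sums over the children. The
value at the source is set to `0`, since the source is listed among its own children. -/
lemma exists_rec_children (f : V → ℝ → ℝ) :
    ∃ g : V → ℝ, g N.source = 0 ∧ ∀ v, v ≠ N.source →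
      g v = f v (∑ w with N.parent w = v, g w) := by
  have wf := N.wellFounded_child
  refine ⟨wf.fix (fun v ih => if v = N.source then 0 else
    f v (∑ w with N.parent w = v,
      if h : N.parent w = v ∧ w ≠ N.source then ih w h else 0)), ?_, fun v hv => ?_⟩
  · rw [wf.fix_eq, if_pos rfl]
  · rw [wf.fix_eq, if_neg hv]
    congr 1
    refine Finset.sum_congr rfl fun w hw => ?_
    have hw' : N.parent w = v := by simpa using hw
    rw [dif_pos ⟨hw', fun h => hv (by rw [← hw', h, N.parent_source])⟩]

/-- The quantity that has given values at the sinks and is conserved at every inner vertex. -/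
lemma exists_subtreeSum (a : V → ℝ) :
    ∃ u : V → ℝ, u N.source = 0 ∧ (∀ v, N.IsSink v → u v = a v) ∧
      ∀ v, v ≠ N.source → ¬ N.IsSink v → u v = ∑ w with N.parent w = v, u w := by
  obtain ⟨u, hu0, hu⟩ := N.exists_rec_children fun v y => if N.IsSink v then a v else y
  exact ⟨u, hu0, fun v hv => by rw [hu v hv.ne_source, if_pos hv],
    fun v hv hs => by rw [hu v hv, if_neg hs]⟩

/-- A quantity that is conserved at every inner vertex leaves the source in the amount that the
sinks receive. -/
lemma sum_children_source {u : V → ℝ} (h0 : u N.source = 0)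
    (hu : ∀ v, v ≠ N.source → ¬ N.IsSink v → u v = ∑ w with N.parent w = v, u w) :
    ∑ w with N.parent w = N.source, u w = ∑ l : N.Sink, u l := by
  have h1 : ∑ v, ∑ w with N.parent w = v, u w = ∑ w, u w :=
    Finset.sum_fiberwise _ _ _
  have h2 : ∀ v, ∑ w with N.parent w = v, u w =
      (if v = N.source then ∑ w with N.parent w = N.source, u w else 0)
        + (u v - if N.IsSink v then u v else 0) := by
    intro v
    by_cases hv : v = N.source
    · subst hv
      simp [N.not_isSink_source, h0]
    · by_cases hs : N.IsSink v
      · simp only [hv, hs, if_true, if_false]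
        rw [Finset.filter_false_of_mem fun w _ => hs w]
        simp
      · simp [hv, hs, hu v hv hs]
  rw [Finset.sum_congr rfl fun v _ => h2 v, Finset.sum_add_distrib, Finset.sum_sub_distrib,
    Finset.sum_ite_eq' Finset.univ, if_pos (Finset.mem_univ _), ← Finset.sum_filter,
    Finset.sum_subtype (p := N.IsSink) (Finset.univ.filter N.IsSink) (by simp) u] at h1
  linarith

end Tree

/-! ### Equilibria without valve settings -/

section Feasible

variable {V : Type*} (N : FlowNetwork V) [Fintype V]

/-- The equilibrium flows that continuous valves can produce, with the valve settings eliminated: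
`Q` is the flow, `h` the head above the common potential of the sinks, `Δ` the head at the source
and `k` the resistances, which are kept as a parameter because they will be perturbed. The valve of
a sink absorbs whatever head is left at its parent. The unused value of `Q` at the source
is normalised to `0`. -/
structure IsFeasible (n : ℝ) (k : V → ℝ) (Δ : ℝ) (Q h : V → ℝ) : Prop where
  flow_source : Q N.source = 0
  flow_nonneg : ∀ v, 0 ≤ Q v
  conserve : ∀ v, v ≠ N.source → ¬ N.IsSink v → Q v = ∑ w with N.parent w = v, Q w
  head_source : h N.source = Δ
  head_nonneg : ∀ v, 0 ≤ h v
  head_sink : ∀ v, N.IsSink v → h v = 0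
  drop : ∀ v, v ≠ N.source → ¬ N.IsSink v → h (N.parent v) - h v = k v * Q v ^ n
  valve : ∀ v, N.IsSink v → k v * Q v ^ n ≤ h (N.parent v)

/-- The equilibrium flows that ON/OFF valves can produce: at every sink either there is no flow or
the terminal edge alone absorbs the head left at its parent. -/
structure IsOnOff (n : ℝ) (k : V → ℝ) (Δ : ℝ) (Q h : V → ℝ) : Prop
    extends N.IsFeasible n k Δ Q h where
  on_or_off : ∀ v, N.IsSink v → Q v = 0 ∨ k v * Q v ^ n = h (N.parent v)

variable {N} {n : ℝ} {k : V → ℝ} {Δ : ℝ} {Q h : V → ℝ}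

lemma IsFeasible.flow_le_parent (hf : N.IsFeasible n k Δ Q h) {v : V}
    (hv : N.parent v ≠ N.source) : Q v ≤ Q (N.parent v) := by
  rw [hf.conserve _ hv (N.not_isSink_parent v)]
  exact Finset.single_le_sum (f := Q) (fun w _ => hf.flow_nonneg w) (by simp)

lemma IsFeasible.drop_le (hf : N.IsFeasible n k Δ Q h) {v : V} (hv : v ≠ N.source) :
    k v * Q v ^ n ≤ h (N.parent v) := by
  by_cases hs : N.IsSink v
  · exact hf.valve v hs
  · have h1 := hf.drop v hv hs
    have h2 := hf.head_nonneg v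
    linarith

lemma IsFeasible.head_le (hf : N.IsFeasible n k Δ Q h) (hk : ∀ v, v ≠ N.source → 0 ≤ k v)
    (v : V) : h v ≤ Δ := by
  induction v using N.parent_induction with
  | h0 => exact hf.head_source.le
  | h v hv ih =>
    by_cases hs : N.IsSink v
    · rw [hf.head_sink v hs, ← hf.head_source]
      exact hf.head_nonneg _
    · have h1 := hf.drop v hv hs
      have h2 := mul_nonneg (hk v hv) (Real.rpow_nonneg (hf.flow_nonneg v) n)
      linarith

/-- An equilibrium never lets the head at an inner vertex fall below that of the sinks: a vertex
with flow feeds some sink, and a vertex without flow is at the head of its parent. -/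
lemma head_nonneg_of_equilibrium (hn : n ≠ 0) (hk : ∀ v, v ≠ N.source → 0 ≤ k v) (hΔ : 0 ≤ Δ)
    (hQ : ∀ v, 0 ≤ Q v)
    (hc : ∀ v, v ≠ N.source → ¬ N.IsSink v → Q v = ∑ w with N.parent w = v, Q w)
    (h0 : h N.source = Δ) (hs : ∀ v, N.IsSink v → h v = 0)
    (hd : ∀ v, v ≠ N.source → ¬ N.IsSink v → h (N.parent v) - h v = k v * Q v ^ n)
    (hp : ∀ v, N.IsSink v → Q v = 0 ∨ 0 ≤ h (N.parent v)) (v : V) : 0 ≤ h v := by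
  have key : ∀ v, v ≠ N.source → ¬ N.IsSink v → Q v ≠ 0 → 0 ≤ h v := by
    intro v
    induction v using N.child_induction with
    | h v ih =>
      intro hv hvs hQv
      rw [hc v hv hvs] at hQv
      obtain ⟨w, hw, hw0⟩ := Finset.exists_ne_zero_of_sum_ne_zero hQv
      have hwp : N.parent w = v := by simpa using hw
      have hw' := N.ne_source_of_parent_eq hv hwp
      by_cases hws : N.IsSink w
      · have := (hp w hws).resolve_left hw0
        rwa [hwp] at this
      · have h1 := ih w hwp hw' hw' hws hw0
        have h2 := hd w hw' hws
        have h3 := mul_nonneg (hk w hw') (Real.rpow_nonneg (hQ w) n)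
        rw [hwp] at h2
        linarith
  induction v using N.parent_induction with
  | h0 => rw [h0]; exact hΔ
  | h v hv ih =>
    by_cases hvs : N.IsSink v
    · exact (hs v hvs).ge
    · by_cases hQv : Q v = 0
      · have h1 := hd v hv hvs
        rw [hQv, Real.zero_rpow hn] at h1
        linarith
      · exact key v hv hvs hQv

/-- An equilibrium flow is feasible after its unused value at the source is changed to `0`. -/
lemma IsEquilibrium.exists_isFeasible (hn : n ≠ 0) {r : N.ValveConfig}
    (he : N.IsEquilibrium n r Q) :
    ∃ Q' h, (∀ v, v ≠ N.source → Q' v = Q v) ∧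
      N.IsFeasible n N.k (N.sourceHead - N.sinkHead) Q' h ∧
      (r ∈ N.onOffConfigs → N.IsOnOff n N.k (N.sourceHead - N.sinkHead) Q' h) := by
  obtain ⟨hQ, hc, H, H0, Hs, Hd, hoff, hon⟩ := he
  set Q' := Function.update Q N.source 0 with hQ'
  have e : ∀ v, v ≠ N.source → Q' v = Q v := fun v hv => Function.update_of_ne hv _ _
  have hQ0 : Q' N.source = 0 := Function.update_self _ _ _
  have hQ1 : ∀ v, 0 ≤ Q' v := by
    intro v
    by_cases hv : v = N.source
    · rw [hv, hQ0]
    · rw [e v hv]; exact hQ v hv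
  have hc' : ∀ v, v ≠ N.source → ¬ N.IsSink v → Q' v = ∑ w with N.parent w = v, Q' w := by
    intro v hv hvs
    rw [e v hv, hc v hv hvs]
    exact Finset.sum_congr rfl fun w hw =>
      (e w (N.ne_source_of_parent_eq hv (by simpa using hw))).symm
  have hsrc : H N.source - N.sinkHead = N.sourceHead - N.sinkHead := by rw [H0]
  have hsink : ∀ v, N.IsSink v → H v - N.sinkHead = 0 := fun v hv => by rw [Hs ⟨v, hv⟩, sub_self]
  have hdrop : ∀ v, v ≠ N.source → ¬ N.IsSink v →
      (H (N.parent v) - N.sinkHead) - (H v - N.sinkHead) = N.k v * Q' v ^ n := by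
    intro v hv hvs
    rw [e v hv, ← Hd v hv hvs]
    ring
  have hopen : ∀ v (hv : N.IsSink v), r ⟨v, hv⟩ ≠ ⊤ →
      H (N.parent v) - N.sinkHead = (N.k v + (r ⟨v, hv⟩).toReal) * Q' v ^ n := by
    intro v hv hr
    rw [e v hv.ne_source, ← hon ⟨v, hv⟩ hr, Hs ⟨v, hv⟩]
  have hclosed : ∀ v (hv : N.IsSink v), r ⟨v, hv⟩ = ⊤ → Q' v = 0 := by
    intro v hv hr
    rw [e v hv.ne_source, hoff ⟨v, hv⟩ hr]
  have hh : ∀ v, 0 ≤ H v - N.sinkHead :=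
    head_nonneg_of_equilibrium (h := fun v => H v - N.sinkHead) hn N.k_nonneg
      (sub_nonneg.2 N.head_lt.le) hQ1 hc' hsrc hsink hdrop fun v hv => by
        by_cases hr : r ⟨v, hv⟩ = ⊤
        · exact Or.inl (hclosed v hv hr)
        · refine Or.inr ?_
          rw [hopen v hv hr]
          exact mul_nonneg (add_nonneg (N.k_nonneg v hv.ne_source) ENNReal.toReal_nonneg)
            (Real.rpow_nonneg (hQ1 v) n)
  have hf : N.IsFeasible n N.k (N.sourceHead - N.sinkHead) Q' (fun v => H v - N.sinkHead) := by
    refine ⟨hQ0, hQ1, hc', hsrc, hh, hsink, hdrop, fun v hv => ?_⟩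
    by_cases hr : r ⟨v, hv⟩ = ⊤
    · rw [hclosed v hv hr, Real.zero_rpow hn, mul_zero]
      exact hh _
    · rw [hopen v hv hr]
      exact mul_le_mul_of_nonneg_right (le_add_of_nonneg_right ENNReal.toReal_nonneg)
        (Real.rpow_nonneg (hQ1 v) n)
  refine ⟨Q', _, e, hf, fun hr => ⟨hf, fun v hv => ?_⟩⟩
  rcases hr ⟨v, hv⟩ with h0 | h0
  · refine Or.inr ?_
    have := hopen v hv (by simp [h0])
    simpa [h0] using this.symm
  · exact Or.inl (hclosed v hv h0)

/-- The valve settings are recovered from the flow: a sink without flow is closed, any other valve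
takes the resistance that is missing. -/
lemma IsFeasible.exists_isEquilibrium (hf : N.IsFeasible n N.k (N.sourceHead - N.sinkHead) Q h) :
    ∃ r : N.ValveConfig, N.IsEquilibrium n r Q ∧
      (N.IsOnOff n N.k (N.sourceHead - N.sinkHead) Q h → r ∈ N.onOffConfigs) := by
  refine ⟨fun l => if Q l = 0 then ⊤ else
    ENNReal.ofReal ((h (N.parent l) - N.k l * Q l ^ n) / Q l ^ n),
    ⟨fun v _ => hf.flow_nonneg v, hf.conserve, fun v => h v + N.sinkHead, ?_, ?_, ?_, ?_, ?_⟩, ?_⟩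
  · simp [hf.head_source]
  · intro l
    simp [hf.head_sink l l.2]
  · intro v hv hvs
    rw [← hf.drop v hv hvs]
    ring
  · intro l hl
    by_contra h0
    simp [h0] at hl
  · intro l hl
    have h0 : Q l ≠ 0 := fun h0 => hl (if_pos h0)
    have hpos : 0 < Q l ^ n := Real.rpow_pos_of_pos ((hf.flow_nonneg l).lt_of_ne' h0) n
    have h1 := hf.valve l l.2
    simp only [h0, if_false]
    rw [ENNReal.toReal_ofReal (div_nonneg (sub_nonneg.2 h1) hpos.le), hf.head_sink l l.2, add_mul,
      div_mul_cancel₀ _ hpos.ne']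
    ring
  · intro ho l
    by_cases h0 : Q l = 0
    · exact Or.inr (if_pos h0)
    · refine Or.inl ?_
      have := (ho.on_or_off l l.2).resolve_left h0
      simp [h0, this]

end Feasible

/-! ### Weighted deliveries with ON/OFF valves -/

/-- Hölder's inequality for `j` equal terms and one more: this is where one more level of the tree
costs its factor. -/
lemma rpow_mul_add_rpow_le {θ j x y : ℝ} (hθ : 0 ≤ θ) (hθ1 : θ ≤ 1) (hj : 0 < j) (hx : 0 ≤ x)
    (hy : 0 ≤ y) :
    j ^ (1 - θ) * x ^ θ + y ^ θ ≤ (j + 1) ^ (1 - θ) * (x + y) ^ θ := by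
  have hj1 : 0 < j + 1 := by linarith
  have h := (Real.concaveOn_rpow hθ hθ1).2 (Set.mem_Ici.2 (div_nonneg hx hj.le)) (Set.mem_Ici.2 hy)
    (show 0 ≤ j / (j + 1) by positivity) (show 0 ≤ 1 / (j + 1) by positivity) (by field_simp)
  have e : j / (j + 1) * (x / j) + 1 / (j + 1) * y = (x + y) / (j + 1) := by field_simp
  simp only [smul_eq_mul] at h
  rw [e, Real.div_rpow hx hj.le, Real.div_rpow (add_nonneg hx hy) hj1.le] at h
  have p1 : 0 < j ^ θ := Real.rpow_pos_of_pos hj θ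
  have p2 : 0 < (j + 1) ^ θ := Real.rpow_pos_of_pos hj1 θ
  rw [Real.rpow_sub hj, Real.rpow_sub hj1, Real.rpow_one, Real.rpow_one]
  calc j / j ^ θ * x ^ θ + y ^ θ
      = (j + 1) * (j / (j + 1) * (x ^ θ / j ^ θ) + 1 / (j + 1) * y ^ θ) := by field_simp
    _ ≤ (j + 1) * ((x + y) ^ θ / (j + 1) ^ θ) := by gcongr
    _ = _ := by ring

section OnOff

variable {V : Type*} {N : FlowNetwork V} [Fintype V] {n : ℝ} {k : V → ℝ} {Δ : ℝ}

variable (N) in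
/-- `G v` is the flow through the edge above `v` and `W v` the weighted delivery (with weights `c`)
to the sinks below it when the sinks in `S` are open, the others are closed, and the edge together
with everything below it is subject to a unit head. For a head `y` both scale with `y ^ (1 / n)`,
and of a unit head the fraction `1 / (1 + k v * A ^ n)` is left at `v`, where `A` is the sum
of `G` over the children of `v`. -/
structure IsUnitResponse (n : ℝ) (k : V → ℝ) (c : V → ℝ) (S : V → Prop) (G W : V → ℝ) : Prop where
  flow_source : G N.source = 0
  value_source : W N.source = 0
  flow_sink : ∀ v, N.IsSink v → G v = if S v then 1 / k v ^ (1 / n) else 0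
  value_sink : ∀ v, N.IsSink v → W v = c v * G v
  flow_inner : ∀ v, v ≠ N.source → ¬ N.IsSink v → G v = (∑ w with N.parent w = v, G w) /
    (1 + k v * (∑ w with N.parent w = v, G w) ^ n) ^ (1 / n)
  value_inner : ∀ v, v ≠ N.source → ¬ N.IsSink v → W v = (∑ w with N.parent w = v, W w) /
    (1 + k v * (∑ w with N.parent w = v, G w) ^ n) ^ (1 / n)

variable (N n k) in
lemma exists_isUnitResponse (c : V → ℝ) (S : V → Prop) :
    ∃ G W, N.IsUnitResponse n k c S G W := by
  obtain ⟨G, hG0, hG⟩ := N.exists_rec_children fun v A =>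
    if N.IsSink v then (if S v then 1 / k v ^ (1 / n) else 0) else
      A / (1 + k v * A ^ n) ^ (1 / n)
  obtain ⟨W, hW0, hW⟩ := N.exists_rec_children fun v B =>
    if N.IsSink v then c v * G v else
      B / (1 + k v * (∑ w with N.parent w = v, G w) ^ n) ^ (1 / n)
  refine ⟨G, W, hG0, hW0, fun v hv => ?_, fun v hv => ?_, fun v hv hs => ?_, fun v hv hs => ?_⟩
  · rw [hG v hv.ne_source, if_pos hv]
  · rw [hW v hv.ne_source, if_pos hv]
  · rw [hG v hv, if_neg hs]
  · rw [hW v hv, if_neg hs]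

variable {c : V → ℝ} {S : V → Prop} {G W : V → ℝ}

lemma IsUnitResponse.flow_nonneg (hr : N.IsUnitResponse n k c S G W)
    (hk : ∀ v, v ≠ N.source → 0 ≤ k v) (v : V) : 0 ≤ G v := by
  induction v using N.child_induction with
  | h v ih =>
    by_cases hv : v = N.source
    · rw [hv, hr.flow_source]
    · by_cases hs : N.IsSink v
      · rw [hr.flow_sink v hs]
        have := Real.rpow_nonneg (hk v hv) (1 / n)
        split_ifs <;> positivity
      · rw [hr.flow_inner v hv hs]
        have hA : 0 ≤ ∑ w with N.parent w = v, G w := Finset.sum_nonneg fun w hw => by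
          have hw' : N.parent w = v := by simpa using hw
          exact ih w hw' (N.ne_source_of_parent_eq hv hw')
        have := hk v hv
        positivity

/-- The unit responses determine the actual flow by distributing the head from the source
downwards. -/
lemma IsUnitResponse.exists_isOnOff (hr : N.IsUnitResponse n k c S G W) (hn : 1 ≤ n)
    (hk : ∀ v, v ≠ N.source → 0 ≤ k v) (hks : ∀ v, N.IsSink v → 0 < k v) (hΔ : 0 ≤ Δ) :
    ∃ q h, N.IsOnOff n k Δ q h ∧
      ∑ l : N.Sink, c l * q l = (∑ w with N.parent w = N.source, W w) * Δ ^ (1 / n) := by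
  have hn0 : n ≠ 0 := by linarith
  have hG := hr.flow_nonneg hk
  set A : V → ℝ := fun v => ∑ w with N.parent w = v, G w with hA
  have hA0 : ∀ v, 0 ≤ A v := fun v => Finset.sum_nonneg fun w _ => hG w
  obtain ⟨h, h0, hh⟩ := N.exists_rec_parent Δ fun v y =>
    if N.IsSink v then 0 else y / (1 + k v * A v ^ n)
  have hd : ∀ v, v ≠ N.source → 0 < 1 + k v * A v ^ n := fun v hv => by
    have := hk v hv
    have := hA0 v
    positivity
  have hh0 : ∀ v, 0 ≤ h v := by
    intro v
    induction v using N.parent_induction with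
    | h0 => rw [h0]; exact hΔ
    | h v hv ih =>
      rw [hh v hv]
      split_ifs
      · exact le_rfl
      · exact div_nonneg ih (hd v hv).le
  have pow_inv : ∀ x : ℝ, 0 ≤ x → (x ^ (1 / n)) ^ n = x := fun x hx => by
    rw [← Real.rpow_mul hx, one_div_mul_cancel hn0, Real.rpow_one]
  -- below an inner vertex all responses are scaled by the head left there
  have hscale : ∀ (X : V → ℝ) v, v ≠ N.source → ¬ N.IsSink v →
      X v = (∑ w with N.parent w = v, X w) / (1 + k v * A v ^ n) ^ (1 / n) →
      X v * h (N.parent v) ^ (1 / n) =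
        ∑ w with N.parent w = v, X w * h (N.parent w) ^ (1 / n) := by
    intro X v hv hs hX
    have : ∀ w ∈ Finset.univ.filter (fun w => N.parent w = v),
        X w * h (N.parent w) ^ (1 / n) = X w * h v ^ (1 / n) := fun w hw => by
      rw [(by simpa using hw : N.parent w = v)]
    rw [Finset.sum_congr rfl this, ← Finset.sum_mul, hh v hv, if_neg hs,
      Real.div_rpow (hh0 _) (hd v hv).le, hX]
    ring
  have hkG : ∀ v, N.IsSink v → S v → k v * (G v * h (N.parent v) ^ (1 / n)) ^ n
      = h (N.parent v) := by
    intro v hv hS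
    have hkv := hks v hv
    rw [Real.mul_rpow (hG v) (Real.rpow_nonneg (hh0 _) _), pow_inv _ (hh0 _), hr.flow_sink v hv,
      if_pos hS, Real.div_rpow zero_le_one (Real.rpow_nonneg hkv.le _), Real.one_rpow,
      pow_inv _ hkv.le]
    field_simp
  have hG0 : ∀ v, N.IsSink v → ¬ S v → G v * h (N.parent v) ^ (1 / n) = 0 := by
    intro v hv hS
    rw [hr.flow_sink v hv, if_neg hS, zero_mul]
  refine ⟨fun v => G v * h (N.parent v) ^ (1 / n), h, ⟨⟨?_, ?_, ?_, h0, hh0, ?_, ?_, ?_⟩, ?_⟩, ?_⟩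
  · simp [hr.flow_source]
  · exact fun v => mul_nonneg (hG v) (Real.rpow_nonneg (hh0 _) _)
  · exact fun v hv hs => hscale G v hv hs (hr.flow_inner v hv hs)
  · exact fun v hv => by rw [hh v hv.ne_source, if_pos hv]
  · intro v hv hs
    have hd' := hd v hv
    rw [Real.mul_rpow (hG v) (Real.rpow_nonneg (hh0 _) _), pow_inv _ (hh0 _),
      hr.flow_inner v hv hs, Real.div_rpow (hA0 v) (Real.rpow_nonneg hd'.le _), pow_inv _ hd'.le,
      hh v hv, if_neg hs]
    field_simp
    ring
  · intro v hv
    by_cases hS : S v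
    · exact (hkG v hv hS).le
    · rw [hG0 v hv hS, Real.zero_rpow hn0, mul_zero]
      exact hh0 _
  · intro v hv
    by_cases hS : S v
    · exact Or.inr (hkG v hv hS)
    · exact Or.inl (hG0 v hv hS)
  · have := N.sum_children_source (u := fun v => W v * h (N.parent v) ^ (1 / n))
      (by simp [hr.value_source]) fun v hv hs => hscale W v hv hs (hr.value_inner v hv hs)
    rw [Finset.sum_mul]
    refine Eq.trans ?_ (this.symm.trans (Finset.sum_congr rfl fun w hw => ?_))
    · exact Finset.sum_congr rfl fun l _ => by rw [hr.value_sink l l.2, mul_assoc]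
    · rw [(by simpa using hw : N.parent w = N.source), h0]

/-- An edge without head above it carries no flow, provided the terminal edges have positive
resistance; so it delivers no value `u` either. -/
lemma IsFeasible.eq_zero_of_head_eq_zero {Q h u : V → ℝ} (hf : N.IsFeasible n k Δ Q h)
    (hk : ∀ v, v ≠ N.source → 0 ≤ k v) (hks : ∀ v, N.IsSink v → 0 < k v)
    (hus : ∀ v, N.IsSink v → u v = c v * Q v)
    (hu : ∀ v, v ≠ N.source → ¬ N.IsSink v → u v = ∑ w with N.parent w = v, u w) {v : V}
    (hv : v ≠ N.source) (hh : h (N.parent v) = 0) : Q v = 0 ∧ u v = 0 := by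
  induction v using N.child_induction with
  | h v ih =>
    by_cases hs : N.IsSink v
    · have h1 := hf.valve v hs
      rw [hh] at h1
      have h2 : Q v ^ n ≤ 0 := nonpos_of_mul_nonpos_right h1 (hks v hs)
      have h3 : Q v = 0 := by
        by_contra h0
        exact absurd (Real.rpow_pos_of_pos ((hf.flow_nonneg v).lt_of_ne' h0) n) (not_lt.2 h2)
      exact ⟨h3, by rw [hus v hs, h3, mul_zero]⟩
    · have h1 := hf.drop v hv hs
      have h2 := mul_nonneg (hk v hv) (Real.rpow_nonneg (hf.flow_nonneg v) n)
      have h3 : h v = 0 := le_antisymm (by linarith) (hf.head_nonneg v)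
      have h4 : ∀ w ∈ Finset.univ.filter (fun w => N.parent w = v), Q w = 0 ∧ u w = 0 :=
        fun w hw => by
          have hw' : N.parent w = v := by simpa using hw
          exact ih w hw' (N.ne_source_of_parent_eq hv hw') (N.ne_source_of_parent_eq hv hw')
            (by rw [hw', h3])
      rw [hf.conserve v hv hs, hu v hv hs]
      exact ⟨Finset.sum_eq_zero fun w hw => (h4 w hw).1,
        Finset.sum_eq_zero fun w hw => (h4 w hw).2⟩

/-- The comparison of continuous and ON/OFF valves in dual form, for positive terminal resistances:
for every weighting of the sinks (of any sign), some choice of open sinks delivers at least the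
fraction `maxDepth ^ (-(1 - 1 / n))` of the weighted delivery of a given feasible flow.

Each edge `v` gets a price `μ v` per unit of flow, fixed from the source downwards, and a sink is
open when its weight exceeds its price. With `φ v` the bound that is to be proved for the net value
of the edge per unit head, the price rises by `φ v * k v ^ (1 / n)` across the edge. -/
lemma IsFeasible.exists_isOnOff_of_pos {Q h : V → ℝ} (hf : N.IsFeasible n k Δ Q h)
    (hn : 1 ≤ n) (hk : ∀ v, v ≠ N.source → 0 ≤ k v) (hks : ∀ v, N.IsSink v → 0 < k v)
    (c : V → ℝ) : ∃ q g, N.IsOnOff n k Δ q g ∧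
      ∑ l : N.Sink, c l * Q l ≤ (N.maxDepth : ℝ) ^ (1 - 1 / n) * ∑ l : N.Sink, c l * q l := by
  have hn0 : n ≠ 0 := by linarith
  have hθ0 : 0 ≤ 1 / n := by positivity
  have hθ1 : 1 / n ≤ 1 := by rw [div_le_one (by linarith)]; exact hn
  have hΔ : 0 ≤ Δ := hf.head_source ▸ hf.head_nonneg _
  have pow_inv : ∀ x : ℝ, 0 ≤ x → (x ^ n) ^ (1 / n) = x := fun x hx => by
    rw [← Real.rpow_mul hx, mul_one_div_cancel hn0, Real.rpow_one]
  obtain ⟨u, hu0, hus, hu⟩ := N.exists_subtreeSum fun v => c v * Q v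
  -- the factor allowed for the levels from `v` downwards
  set β : V → ℝ := fun v => ((N.maxDepth : ℝ) - N.depth v + 1) ^ (1 - 1 / n) with hβ
  have hlev : ∀ v, (0 : ℝ) ≤ (N.maxDepth : ℝ) - N.depth v := fun v =>
    sub_nonneg.2 (Nat.cast_le.2 (N.depth_le_maxDepth v))
  have hβ1 : ∀ v, 1 ≤ β v := fun v =>
    Real.one_le_rpow (by linarith [hlev v]) (sub_nonneg.2 hθ1)
  -- the net value to be achieved on the edge above `v` per unit head, at the price `m`; without
  -- head above `v` there is no flow, so that the value `0` of the quotient is the right one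
  set F : V → ℝ → ℝ := fun v m => max 0 ((u v - m * Q v) / (β v * h (N.parent v) ^ (1 / n)))
  obtain ⟨μ, -, hμ⟩ := N.exists_rec_parent (0 : ℝ) fun v m =>
    if N.parent v = N.source then 0 else
      m + F (N.parent v) m * k (N.parent v) ^ (1 / n)
  set φ : V → ℝ := fun v => F v (μ v)
  have hφ0 : ∀ v, 0 ≤ φ v := fun v => le_max_left _ _
  have hμ' : ∀ v w, v ≠ N.source → N.parent w = v → μ w = μ v + φ v * k v ^ (1 / n) := by
    rintro v w hv rfl
    rw [hμ w (N.ne_source_of_parent_eq hv rfl), if_neg hv]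
  have hzero : ∀ v, v ≠ N.source → h (N.parent v) = 0 → Q v = 0 ∧ u v = 0 := fun v hv =>
    hf.eq_zero_of_head_eq_zero hk hks hus hu hv
  have hval : ∀ v, v ≠ N.source → u v - μ v * Q v ≤ φ v * (β v * h (N.parent v) ^ (1 / n)) := by
    intro v hv
    rcases (hf.head_nonneg (N.parent v)).eq_or_lt with h0 | h0
    · obtain ⟨h1, h2⟩ := hzero v hv h0.symm
      rw [h1, h2, ← h0, mul_zero, sub_zero]
      have := zero_le_one.trans (hβ1 v)
      have := hφ0 v
      positivity
    · have : 0 < β v * h (N.parent v) ^ (1 / n) :=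
        mul_pos (zero_lt_one.trans_le (hβ1 v)) (Real.rpow_pos_of_pos h0 _)
      exact (div_le_iff₀ this).1 (le_max_right _ _)
  have hval' : ∀ v, 0 < φ v → 0 < h (N.parent v) ∧
      u v - μ v * Q v = φ v * (β v * h (N.parent v) ^ (1 / n)) := by
    intro v hv
    have h1 : φ v = (u v - μ v * Q v) / (β v * h (N.parent v) ^ (1 / n)) :=
      (max_choice _ _).resolve_left hv.ne'
    have h2 : β v * h (N.parent v) ^ (1 / n) ≠ 0 := fun h => by
      rw [h1, h, div_zero] at hv
      exact lt_irrefl _ hv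
    refine ⟨(hf.head_nonneg _).lt_of_ne' fun h => h2 ?_, by rw [h1, div_mul_cancel₀ _ h2]⟩
    rw [h, Real.zero_rpow (one_div_ne_zero hn0), mul_zero]
  obtain ⟨G, W, hr⟩ := N.exists_isUnitResponse n k c (fun v => μ v < c v)
  have hG := hr.flow_nonneg hk
  have claim : ∀ v, v ≠ N.source → φ v ≤ W v - μ v * G v := by
    intro v
    induction v using N.child_induction with
    | h v ih =>
      intro hv
      by_cases hs : N.IsSink v
      · have hκ : 0 < k v ^ (1 / n) := Real.rpow_pos_of_pos (hks v hs) _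
        rw [hr.value_sink v hs, hr.flow_sink v hs]
        have hQ : k v ^ (1 / n) * Q v ≤ h (N.parent v) ^ (1 / n) := by
          have := Real.rpow_le_rpow (mul_nonneg (hk v hv) (Real.rpow_nonneg (hf.flow_nonneg v) n))
            (hf.valve v hs) hθ0
          rwa [Real.mul_rpow (hk v hv) (Real.rpow_nonneg (hf.flow_nonneg v) n),
            pow_inv _ (hf.flow_nonneg v)] at this
        rcases (hφ0 v).eq_or_lt with h0 | h0
        · rw [← h0]
          split_ifs with hc
          · rw [← sub_mul]
            exact mul_nonneg (sub_nonneg.2 hc.le) (by positivity)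
          · simp
        · obtain ⟨h1, h2⟩ := hval' v h0
          have h3 : 0 < h (N.parent v) ^ (1 / n) := Real.rpow_pos_of_pos h1 _
          rw [hus v hs, ← sub_mul] at h2
          have h4 : φ v * h (N.parent v) ^ (1 / n) ≤ (c v - μ v) * Q v := by
            rw [h2]
            have := le_mul_of_one_le_left (mul_nonneg h0.le h3.le) (hβ1 v)
            linarith
          have h5 : 0 < (c v - μ v) * Q v := (mul_pos h0 h3).trans_le h4
          have hc : 0 < c v - μ v := pos_of_mul_pos_left h5 (hf.flow_nonneg v)
          rw [if_pos (sub_pos.1 hc), ← sub_mul, mul_one_div, le_div_iff₀ hκ]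
          refine le_of_mul_le_mul_right ?_ h3
          calc φ v * k v ^ (1 / n) * h (N.parent v) ^ (1 / n)
              = k v ^ (1 / n) * (φ v * h (N.parent v) ^ (1 / n)) := by ring
            _ ≤ k v ^ (1 / n) * ((c v - μ v) * Q v) := by gcongr
            _ = (c v - μ v) * (k v ^ (1 / n) * Q v) := by ring
            _ ≤ (c v - μ v) * h (N.parent v) ^ (1 / n) := by gcongr
      · obtain ⟨x₀, hx₀⟩ : ∃ w, N.parent w = v := by
          by_contra hcon
          push Not at hcon
          exact hs hcon
        have hch : ∀ w ∈ Finset.univ.filter (fun w => N.parent w = v), N.parent w = v :=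
          fun w hw => by simpa using hw
        have hne : ∀ w, N.parent w = v → w ≠ N.source := fun w hw =>
          N.ne_source_of_parent_eq hv hw
        set κ := k v ^ (1 / n) with hκ
        have hκ0 : 0 ≤ κ := Real.rpow_nonneg (hk v hv) _
        set A := ∑ w with N.parent w = v, G w with hA
        set B := ∑ w with N.parent w = v, W w with hB
        have hA0 : 0 ≤ A := Finset.sum_nonneg fun w _ => hG w
        set j : ℝ := (N.maxDepth : ℝ) - N.depth v
        have hdep : ∀ w, N.parent w = v → (N.maxDepth : ℝ) - N.depth w + 1 = j := fun w hw => by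
          rw [N.depth_eq_succ (hne w hw), hw]
          push_cast
          ring
        have hj1 : 1 ≤ j := by
          have := hlev x₀
          rw [← hdep x₀ hx₀]
          linarith
        set y := h v ^ (1 / n)
        have hy0 : 0 ≤ y := Real.rpow_nonneg (hf.head_nonneg v) _
        -- the children are judged at the price raised by the edge above `v`
        have net : B - (μ v + φ v * κ) * A =
            ∑ w with N.parent w = v, (W w - μ w * G w) := by
          rw [Finset.sum_sub_distrib, hB, hA, Finset.mul_sum]
          congr 1
          exact Finset.sum_congr rfl fun w hw => by rw [hμ' v w hv (hch w hw)]
        have net0 : 0 ≤ B - (μ v + φ v * κ) * A := by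
          rw [net]
          exact Finset.sum_nonneg fun w hw =>
            (hφ0 w).trans (ih w (hch w hw) (hne w (hch w hw)) (hne w (hch w hw)))
        have net1 : u v - (μ v + φ v * κ) * Q v ≤
            (B - (μ v + φ v * κ) * A) * (j ^ (1 - 1 / n) * y) := by
          rw [net, hu v hv hs, hf.conserve v hv hs, Finset.mul_sum, ← Finset.sum_sub_distrib,
            Finset.sum_mul]
          refine Finset.sum_le_sum fun w hw => ?_
          have hw' := hch w hw
          have h1 := hval w (hne w hw')
          have h2 : β w = j ^ (1 - 1 / n) := by rw [hβ]; simp only [hdep w hw']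
          rw [hw', h2, hμ' v w hv hw'] at h1
          refine h1.trans (mul_le_mul_of_nonneg_right ?_ (by positivity))
          exact ih w hw' (hne w hw') (hne w hw')
        -- what the raised price takes from the given flow is made up by Hölder's inequality
        have main : φ v ≤ B - (μ v + φ v * κ) * A := by
          rcases (hφ0 v).eq_or_lt with h0 | h0
          · rw [← h0] at net0 ⊢
            exact net0
          · obtain ⟨h1, h2⟩ := hval' v h0
            have hkQ : (k v * Q v ^ n) ^ (1 / n) = κ * Q v := by
              rw [Real.mul_rpow (hk v hv) (Real.rpow_nonneg (hf.flow_nonneg v) n),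
                pow_inv _ (hf.flow_nonneg v)]
            have hhol := rpow_mul_add_rpow_le hθ0 hθ1 (zero_lt_one.trans_le hj1)
              (hf.head_nonneg v) (mul_nonneg (hk v hv) (Real.rpow_nonneg (hf.flow_nonneg v) n))
            rw [hkQ, ← hf.drop v hv hs, add_sub_cancel] at hhol
            have h3 : φ v * (j ^ (1 - 1 / n) * y) ≤
                (B - (μ v + φ v * κ) * A) * (j ^ (1 - 1 / n) * y) := by
              refine le_trans ?_ net1
              have h4 := mul_le_mul_of_nonneg_left hhol h0.le
              have h5 : u v - (μ v + φ v * κ) * Q v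
                = φ v * ((j + 1) ^ (1 - 1 / n) * h (N.parent v) ^ (1 / n)) - φ v * (κ * Q v) := by
                have : β v = (j + 1) ^ (1 - 1 / n) := rfl
                rw [← this, ← h2]
                ring
              rw [h5]
              linarith
            refine le_of_mul_le_mul_right h3 (mul_pos (Real.rpow_pos_of_pos (by linarith) _)
              (Real.rpow_pos_of_pos ((hf.head_nonneg v).lt_of_ne' fun h4 => h1.ne' ?_) _))
            -- if no head is left at `v`, there is no flow, hence no head above `v` either
            have h5 : Q v = 0 := by
              rw [hf.conserve v hv hs]
              exact Finset.sum_eq_zero fun w hw =>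
                (hzero w (hne w (hch w hw)) (by rw [hch w hw, h4])).1
            have h6 := hf.drop v hv hs
            rw [h4, h5, Real.zero_rpow hn0] at h6
            linarith
        have hpos : 0 < 1 + k v * A ^ n := by
          have := hk v hv
          positivity
        rw [hr.flow_inner v hv hs, hr.value_inner v hv hs, ← hA, ← hB, mul_div_assoc', ← sub_div,
          le_div_iff₀ (Real.rpow_pos_of_pos hpos _)]
        have hmink : (1 + k v * A ^ n) ^ (1 / n) ≤ 1 + κ * A := by
          have h1 := Real.rpow_add_rpow_le_add zero_le_one (mul_nonneg hκ0 hA0) hn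
          rwa [Real.one_rpow, Real.mul_rpow hκ0 hA0, hκ, ← Real.rpow_mul (hk v hv),
            one_div_mul_cancel hn0, Real.rpow_one] at h1
        have := mul_le_mul_of_nonneg_left hmink (hφ0 v)
        linarith
  obtain ⟨q, g, hq, hcq⟩ := hr.exists_isOnOff hn hk hks hΔ
  refine ⟨q, g, hq, ?_⟩
  have hsum := N.sum_children_source hu0 hu
  rw [hcq, ← Finset.sum_congr rfl fun (l : N.Sink) _ => hus l l.2, ← hsum, Finset.sum_mul,
    Finset.mul_sum]
  refine Finset.sum_le_sum fun w hw => ?_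
  have hw' : N.parent w = N.source := by simpa using hw
  by_cases hws : w = N.source
  · rw [hws, hu0, hr.value_source]
    simp
  · have h1 := hval w hws
    have h2 := claim w hws
    have h3 : μ w = 0 := by rw [hμ w hws, if_pos hw']
    have h4 : β w = (N.maxDepth : ℝ) ^ (1 - 1 / n) := by
      simp only [hβ]
      rw [N.depth_eq_succ hws, hw', N.depth_source]
      congr 1
      push_cast
      ring
    rw [h3, zero_mul, sub_zero] at h1 h2
    rw [h4, hw', hf.head_source] at h1
    refine h1.trans ?_
    have h5 : 0 ≤ (N.maxDepth : ℝ) ^ (1 - 1 / n) * Δ ^ (1 / n) :=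
      mul_nonneg (Real.rpow_nonneg (Nat.cast_nonneg _) _) (Real.rpow_nonneg hΔ _)
    calc φ w * ((N.maxDepth : ℝ) ^ (1 - 1 / n) * Δ ^ (1 / n))
        ≤ W w * ((N.maxDepth : ℝ) ^ (1 - 1 / n) * Δ ^ (1 / n)) := by gcongr
      _ = _ := by ring

end OnOff

/-! ### Short-circuited terminal edges -/

section Compact

variable {V : Type*} {N : FlowNetwork V} [Fintype V] {n : ℝ}

variable (N n) in
lemma isClosed_setOf_isFeasible (hn : 0 ≤ n) :
    IsClosed {p : (V → ℝ) × ℝ × (V → ℝ) × (V → ℝ) |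
      N.IsFeasible n p.1 p.2.1 p.2.2.1 p.2.2.2} := by
  have h : {p : (V → ℝ) × ℝ × (V → ℝ) × (V → ℝ) | N.IsFeasible n p.1 p.2.1 p.2.2.1 p.2.2.2} =
      {p | p.2.2.1 N.source = 0 ∧ (∀ v, 0 ≤ p.2.2.1 v) ∧
        (∀ v, v ≠ N.source → ¬ N.IsSink v →
          p.2.2.1 v = ∑ w with N.parent w = v, p.2.2.1 w) ∧
        p.2.2.2 N.source = p.2.1 ∧ (∀ v, 0 ≤ p.2.2.2 v) ∧
        (∀ v, N.IsSink v → p.2.2.2 v = 0) ∧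
        (∀ v, v ≠ N.source → ¬ N.IsSink v →
          p.2.2.2 (N.parent v) - p.2.2.2 v = p.1 v * p.2.2.1 v ^ n) ∧
        (∀ v, N.IsSink v → p.1 v * p.2.2.1 v ^ n ≤ p.2.2.2 (N.parent v))} := by
    ext p
    exact ⟨fun ⟨a, b, c, d, e, f, g, i⟩ => ⟨a, b, c, d, e, f, g, i⟩,
      fun ⟨a, b, c, d, e, f, g, i⟩ => ⟨a, b, c, d, e, f, g, i⟩⟩
  have hc : ∀ v, Continuous fun p : (V → ℝ) × ℝ × (V → ℝ) × (V → ℝ) => p.1 v * p.2.2.1 v ^ n :=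
    fun v => Continuous.mul (by fun_prop)
      (Continuous.rpow_const (by fun_prop) fun _ => Or.inr hn)
  rw [h]
  simp only [Set.ofPred_and, Set.ofPred_forall]
  refine IsClosed.inter ?_ (IsClosed.inter ?_ (IsClosed.inter ?_ (IsClosed.inter ?_
    (IsClosed.inter ?_ (IsClosed.inter ?_ (IsClosed.inter ?_ ?_))))))
  · exact isClosed_eq (by fun_prop) (by fun_prop)
  · exact isClosed_iInter fun v => isClosed_le (by fun_prop) (by fun_prop)
  · exact isClosed_iInter fun v => isClosed_iInter fun _ => isClosed_iInter fun _ =>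
      isClosed_eq (by fun_prop) (by fun_prop)
  · exact isClosed_eq (by fun_prop) (by fun_prop)
  · exact isClosed_iInter fun v => isClosed_le (by fun_prop) (by fun_prop)
  · exact isClosed_iInter fun v => isClosed_iInter fun _ =>
      isClosed_eq (by fun_prop) (by fun_prop)
  · exact isClosed_iInter fun v => isClosed_iInter fun _ => isClosed_iInter fun _ =>
      isClosed_eq (by fun_prop) (hc v)
  · exact isClosed_iInter fun v => isClosed_iInter fun _ => isClosed_le (hc v) (by fun_prop)

variable (N n) in
lemma isClosed_setOf_isOnOff (hn : 0 ≤ n) :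
    IsClosed {p : (V → ℝ) × ℝ × (V → ℝ) × (V → ℝ) |
      N.IsOnOff n p.1 p.2.1 p.2.2.1 p.2.2.2} := by
  have h : {p : (V → ℝ) × ℝ × (V → ℝ) × (V → ℝ) | N.IsOnOff n p.1 p.2.1 p.2.2.1 p.2.2.2} =
      {p | N.IsFeasible n p.1 p.2.1 p.2.2.1 p.2.2.2 ∧ ∀ v, N.IsSink v →
        p.2.2.1 v = 0 ∨ p.1 v * p.2.2.1 v ^ n = p.2.2.2 (N.parent v)} := by
    ext p
    exact ⟨fun ⟨a, b⟩ => ⟨a, b⟩, fun ⟨a, b⟩ => ⟨a, b⟩⟩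
  rw [h]
  simp only [Set.ofPred_and, Set.ofPred_forall]
  refine (N.isClosed_setOf_isFeasible n hn).inter (isClosed_iInter fun v => isClosed_iInter fun _ =>
    IsClosed.union (isClosed_eq (by fun_prop) (by fun_prop)) (isClosed_eq ?_ (by fun_prop)))
  exact Continuous.mul (by fun_prop) (Continuous.rpow_const (by fun_prop) fun _ => Or.inr hn)

variable (N) in
/-- Raising resistances and bounding the head keeps all flows bounded: on the way to each sink there
is an edge of positive resistance. -/
lemma exists_flow_bound (hn : 0 < n) (C : ℝ) :
    ∃ M : ℝ, ∀ (k : V → ℝ) (Δ : ℝ) (Q h : V → ℝ), (∀ v, v ≠ N.source → N.k v ≤ k v) → Δ ≤ C →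
      N.IsFeasible n k Δ Q h → ∀ v, Q v ≤ M := by
  have key : ∀ v, ∃ M : ℝ, ∀ (k : V → ℝ) (Δ : ℝ) (Q h : V → ℝ),
      (∀ v, v ≠ N.source → N.k v ≤ k v) → Δ ≤ C → N.IsFeasible n k Δ Q h → Q v ≤ M := by
    intro v
    induction v using N.child_induction with
    | h v ih =>
      by_cases hv : v = N.source
      · exact ⟨0, fun k Δ Q h _ _ hf => by rw [hv, hf.flow_source]⟩
      · by_cases hs : N.IsSink v
        · obtain ⟨j, hj, hpos⟩ := N.path_pos v hs
          refine ⟨(C / N.k (N.parent^[j] v)) ^ (1 / n), fun k Δ Q h hk hΔ hf => ?_⟩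
          have hle : ∀ i, N.parent^[i] v ≠ N.source → Q v ≤ Q (N.parent^[i] v) := by
            intro i
            induction i with
            | zero => exact fun _ => le_rfl
            | succ i ihi =>
              intro hi
              rw [Function.iterate_succ_apply'] at hi ⊢
              refine (ihi fun h0 => hi ?_).trans (hf.flow_le_parent hi)
              rw [h0, N.parent_source]
          refine (hle j hj).trans ?_
          set e := N.parent^[j] v
          have h1 : N.k e * Q e ^ n ≤ C := by
            have h2 := mul_le_mul_of_nonneg_right (hk e hj)
              (Real.rpow_nonneg (hf.flow_nonneg e) n)
            have h3 := hf.head_le (fun v hv => (N.k_nonneg v hv).trans (hk v hv)) (N.parent e)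
            linarith [hf.drop_le hj]
          have h4 : Q e ^ n ≤ C / N.k e := by
            rw [le_div_iff₀ hpos]
            linarith
          have h5 := Real.rpow_le_rpow (Real.rpow_nonneg (hf.flow_nonneg e) n) h4
            (one_div_nonneg.2 hn.le)
          rwa [← Real.rpow_mul (hf.flow_nonneg e), mul_one_div_cancel hn.ne', Real.rpow_one] at h5
        · have ih' : ∀ x, ∃ M : ℝ, N.parent x = v → ∀ (k : V → ℝ) (Δ : ℝ) (Q h : V → ℝ),
              (∀ v, v ≠ N.source → N.k v ≤ k v) → Δ ≤ C → N.IsFeasible n k Δ Q h → Q x ≤ M := by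
            intro x
            by_cases hx : N.parent x = v
            · obtain ⟨M, hM⟩ := ih x hx (N.ne_source_of_parent_eq hv hx)
              exact ⟨M, fun _ => hM⟩
            · exact ⟨0, fun h => absurd h hx⟩
          choose M hM using ih'
          refine ⟨∑ w with N.parent w = v, M w, fun k Δ Q h hk hΔ hf => ?_⟩
          rw [hf.conserve v hv hs]
          exact Finset.sum_le_sum fun w hw => hM w (by simpa using hw) k Δ Q h hk hΔ hf
  choose M hM using key
  exact ⟨∑ v, |M v|, fun k Δ Q h hk hΔ hf v => (hM v k Δ Q h hk hΔ hf).trans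
    ((le_abs_self _).trans (Finset.single_le_sum (f := fun v => |M v|)
      (fun w _ => abs_nonneg _) (Finset.mem_univ v)))⟩

/-- The comparison in dual form without the assumption on the terminal resistances: these are raised
by `ε`, and the head at the source is raised so that the given flow stays feasible; the ON/OFF flows
obtained stay in a compact set as `ε` tends to `0`. -/
lemma IsFeasible.exists_isOnOff {Δ : ℝ} {Q h : V → ℝ} (hf : N.IsFeasible n N.k Δ Q h)
    (hn : 1 ≤ n) (c : V → ℝ) : ∃ q g, N.IsOnOff n N.k Δ q g ∧
      ∑ l : N.Sink, c l * Q l ≤ (N.maxDepth : ℝ) ^ (1 - 1 / n) * ∑ l : N.Sink, c l * q l := by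
  have hn0 : 0 < n := by linarith
  set κ : ℝ → V → ℝ := fun ε v => N.k v + if N.IsSink v then ε else 0 with hκ
  set B : ℝ := ∑ v, Q v ^ n with hB
  have hQn : ∀ v, 0 ≤ Q v ^ n := fun v => Real.rpow_nonneg (hf.flow_nonneg v) n
  have hB0 : 0 ≤ B := Finset.sum_nonneg fun v _ => hQn v
  have hκ0 : ∀ ε, 0 ≤ ε → ∀ v, N.k v ≤ κ ε v := fun ε hε v => by
    rw [hκ]
    dsimp only
    split_ifs <;> linarith
  obtain ⟨M, hM⟩ := N.exists_flow_bound hn0 (Δ + B)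
  set Z : Set (ℝ × (V → ℝ) × (V → ℝ)) :=
    (Set.Icc 0 1 ×ˢ Set.Icc 0 (fun _ => M) ×ˢ Set.Icc 0 (fun _ => Δ + B)) ∩
      ({p | N.IsOnOff n (κ p.1) (Δ + p.1 * B) p.2.1 p.2.2} ∩
        {p | ∑ l : N.Sink, c l * Q l ≤
          (N.maxDepth : ℝ) ^ (1 - 1 / n) * ∑ l : N.Sink, c l * p.2.1 l}) with hZ
  have hZc : IsCompact Z := by
    refine (isCompact_Icc.prod (isCompact_Icc.prod isCompact_Icc)).inter_right
      (IsClosed.inter ?_ (isClosed_le (by fun_prop) (by fun_prop)))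
    refine (N.isClosed_setOf_isOnOff n hn0.le).preimage
      (f := fun p : ℝ × (V → ℝ) × (V → ℝ) => (κ p.1, Δ + p.1 * B, p.2.1, p.2.2)) ?_
    refine Continuous.prodMk (continuous_pi fun v => ?_) (by fun_prop)
    by_cases hs : N.IsSink v <;> simp only [hκ, hs, if_true, if_false] <;> fun_prop
  have hsub : Set.Ioc (0 : ℝ) 1 ⊆ Prod.fst '' Z := by
    rintro ε ⟨hε, hε1⟩
    have hle : Δ + ε * B ≤ Δ + B := by nlinarith
    have hk : ∀ v, v ≠ N.source → 0 ≤ κ ε v := fun v hv =>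
      (N.k_nonneg v hv).trans (hκ0 ε hε.le v)
    have hf' : N.IsFeasible n (κ ε) (Δ + ε * B) Q
        (fun v => if N.IsSink v then 0 else h v + ε * B) := by
      refine ⟨hf.flow_source, hf.flow_nonneg, hf.conserve, ?_, fun v => ?_, fun v hv => if_pos hv,
        fun v hv hs => ?_, fun v hv => ?_⟩
      · rw [if_neg N.not_isSink_source, hf.head_source]
      · split_ifs
        · exact le_rfl
        · have := hf.head_nonneg v
          positivity
      · simp only [hκ, if_neg hs, if_neg (N.not_isSink_parent v)]
        rw [add_zero, ← hf.drop v hv hs]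
        ring
      · simp only [hκ, if_pos hv, if_neg (N.not_isSink_parent v)]
        rw [add_mul]
        have h1 : Q v ^ n ≤ B :=
          Finset.single_le_sum (f := fun v => Q v ^ n) (fun w _ => hQn w) (Finset.mem_univ v)
        have h2 := mul_le_mul_of_nonneg_left h1 hε.le
        linarith [hf.valve v hv]
    obtain ⟨q, g, hq, hcq⟩ := hf'.exists_isOnOff_of_pos hn hk (fun v hv => by
      have := N.k_nonneg v hv.ne_source
      simp only [hκ, if_pos hv]
      linarith) c
    refine ⟨(ε, q, g), ⟨⟨⟨hε.le, hε1⟩, ⟨fun v => hq.flow_nonneg v, fun v => ?_⟩,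
      ⟨fun v => hq.head_nonneg v, fun v => ?_⟩⟩, hq, hcq⟩, rfl⟩
    · exact hM _ _ _ _ (fun v _ => hκ0 ε hε.le v) hle hq.toIsFeasible v
    · exact (hq.toIsFeasible.head_le hk v).trans hle
  have h0 : (0 : ℝ) ∈ Prod.fst '' Z := by
    refine closure_minimal hsub (hZc.image continuous_fst).isClosed ?_
    rw [closure_Ioc zero_ne_one]
    exact ⟨le_rfl, zero_le_one⟩
  obtain ⟨⟨ε, q, g⟩, ⟨-, hq, hcq⟩, rfl⟩ := h0
  have hκ' : κ (0 : ℝ) = N.k := by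
    funext v
    simp [hκ]
  refine ⟨q, g, ?_, hcq⟩
  have hq' : N.IsOnOff n (κ 0) (Δ + 0 * B) q g := hq
  rwa [hκ', zero_mul, add_zero] at hq'

/-! ### Deliveries and schedules -/

variable (N n) in
/-- The rates at which the sinks are served by the flows that continuous valves can produce. -/
def feasibleRates : Set (N.Sink → ℝ) :=
  {x | ∃ Q h, N.IsFeasible n N.k (N.sourceHead - N.sinkHead) Q h ∧ x = fun l : N.Sink => Q l}

variable (N n) in
/-- The rates at which the sinks are served by the flows that ON/OFF valves can produce. -/
def onOffRates : Set (N.Sink → ℝ) :=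
  {x | ∃ Q h, N.IsOnOff n N.k (N.sourceHead - N.sinkHead) Q h ∧ x = fun l : N.Sink => Q l}

lemma isCompact_rates_of_isClosed (hn : 0 < n) {P : (V → ℝ) → (V → ℝ) → Prop}
    (hP : IsClosed {p : (V → ℝ) × (V → ℝ) | P p.1 p.2})
    (hPf : ∀ Q h, P Q h → N.IsFeasible n N.k (N.sourceHead - N.sinkHead) Q h) :
    IsCompact {x | ∃ Q h, P Q h ∧ x = fun l : N.Sink => Q l} := by
  obtain ⟨M, hM⟩ := N.exists_flow_bound hn (N.sourceHead - N.sinkHead)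
  have hc : IsCompact ((Set.Icc 0 (fun _ => M) ×ˢ
      Set.Icc 0 (fun _ => N.sourceHead - N.sinkHead)) ∩ {p : (V → ℝ) × (V → ℝ) | P p.1 p.2}) :=
    (isCompact_Icc.prod isCompact_Icc).inter_right hP
  convert hc.image (f := fun p : (V → ℝ) × (V → ℝ) => fun l : N.Sink => p.1 l) (by fun_prop)
    using 1
  ext x
  constructor
  · rintro ⟨Q, h, hp, rfl⟩
    have hf := hPf Q h hp
    exact ⟨(Q, h), ⟨⟨⟨hf.flow_nonneg, hM _ _ _ _ (fun _ _ => le_rfl) le_rfl hf⟩,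
      ⟨hf.head_nonneg, hf.head_le N.k_nonneg⟩⟩, hp⟩, rfl⟩
  · rintro ⟨⟨Q, h⟩, ⟨-, hp⟩, rfl⟩
    exact ⟨Q, h, hp, rfl⟩

lemma isCompact_feasibleRates (hn : 0 < n) : IsCompact (N.feasibleRates n) :=
  isCompact_rates_of_isClosed hn ((N.isClosed_setOf_isFeasible n hn.le).preimage
    (f := fun p : (V → ℝ) × (V → ℝ) => (N.k, N.sourceHead - N.sinkHead, p.1, p.2))
    (by fun_prop)) fun _ _ h => h

lemma isCompact_onOffRates (hn : 0 < n) : IsCompact (N.onOffRates n) :=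
  isCompact_rates_of_isClosed hn ((N.isClosed_setOf_isOnOff n hn.le).preimage
    (f := fun p : (V → ℝ) × (V → ℝ) => (N.k, N.sourceHead - N.sinkHead, p.1, p.2))
    (by fun_prop)) fun _ _ h => h.toIsFeasible

/-- The convex hull of a compact set in finite dimension is compact: by Carathéodory's theorem it is
the image of a product of a simplex and finitely many copies of the set. -/
lemma isCompact_convexHull_of_isCompact {E : Type*} [NormedAddCommGroup E] [NormedSpace ℝ E]
    [FiniteDimensional ℝ E] {s : Set E} (hs : IsCompact s) : IsCompact (convexHull ℝ s) := by
  set d := Module.finrank ℝ E with hd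
  have hc : IsCompact (stdSimplex ℝ (Fin (d + 1)) ×ˢ
      Set.pi Set.univ fun _ : Fin (d + 1) => s) :=
    (isCompact_stdSimplex ℝ _).prod (isCompact_univ_pi fun _ => hs)
  convert hc.image (f := fun p : (Fin (d + 1) → ℝ) × (Fin (d + 1) → E) => ∑ i, p.1 i • p.2 i)
    (by fun_prop) using 1
  ext x
  constructor
  · intro hx
    obtain ⟨ι, _, z, w, hz, hi, hw, hw1, rfl⟩ := eq_pos_convex_span_of_mem_convexHull hx
    have hcard : Fintype.card ι ≤ Fintype.card (Fin (d + 1)) := by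
      rw [Fintype.card_fin]
      exact hi.card_le_finrank_succ.trans (Nat.succ_le_succ (Submodule.finrank_le _))
    obtain ⟨e⟩ := Function.Embedding.nonempty_of_card_le hcard
    obtain ⟨i₀⟩ : Nonempty ι := by
      by_contra h
      rw [not_nonempty_iff] at h
      simp at hw1
    have hw0 : ∀ j ∉ Set.range e, Function.extend e w 0 j = 0 := fun j hj =>
      Function.extend_apply' _ _ _ fun ⟨i, hi⟩ => hj ⟨i, hi⟩
    refine ⟨(Function.extend e w 0, Function.extend e z fun _ => z i₀), ⟨⟨fun j => ?_, ?_⟩,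
      fun j _ => ?_⟩, ?_⟩
    · dsimp only
      by_cases hj : j ∈ Set.range e
      · obtain ⟨i, rfl⟩ := hj
        rw [e.injective.extend_apply]
        exact (hw i).le
      · exact (hw0 j hj).ge
    · rw [← hw1]
      exact (Fintype.sum_of_injective e e.injective _ _ hw0
        fun i => (e.injective.extend_apply _ _ _).symm).symm
    · dsimp only
      by_cases hj : j ∈ Set.range e
      · obtain ⟨i, rfl⟩ := hj
        rw [e.injective.extend_apply]
        exact hz ⟨i, rfl⟩
      · rw [Function.extend_apply' _ _ _ fun ⟨i, hi⟩ => hj ⟨i, hi⟩]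
        exact hz ⟨i₀, rfl⟩
    · refine (Fintype.sum_of_injective e e.injective _ _ (fun j hj => ?_) fun i => ?_).symm
      · dsimp only
        rw [hw0 j hj, zero_smul]
      · dsimp only
        rw [e.injective.extend_apply, e.injective.extend_apply]
  · rintro ⟨⟨w, z⟩, ⟨hw, hz⟩, rfl⟩
    exact mem_convexHull_of_exists_fintype w z hw.1 hw.2 (fun i => hz i (Set.mem_univ i)) rfl

open scoped Pointwise in
/-- By Hahn-Banach, the dual form of the comparison says that every feasible delivery is an average
of ON/OFF deliveries, up to the factor. -/
lemma feasibleRates_subset (hn : 1 ≤ n) : N.feasibleRates n ⊆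
    ((N.maxDepth : ℝ) ^ (1 - 1 / n)) • convexHull ℝ (N.onOffRates n) := by
  rintro x ⟨Q, h, hf, rfl⟩
  by_contra hx
  set b : ℝ := (N.maxDepth : ℝ) ^ (1 - 1 / n) with hb
  have hcomp := isCompact_convexHull_of_isCompact
    (isCompact_onOffRates (N := N) (n := n) (by linarith))
  obtain ⟨f, u, hu, hu'⟩ := geometric_hahn_banach_closed_point
    ((convex_convexHull ℝ (N.onOffRates n)).smul b) (hcomp.smul b).isClosed hx
  have hfe : ∀ y : N.Sink → ℝ, f y = ∑ l, f (Pi.single l 1) * y l := by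
    intro y
    conv_lhs => rw [← Finset.univ_sum_single y]
    rw [map_sum]
    refine Finset.sum_congr rfl fun l _ => ?_
    have : (Pi.single l (y l) : N.Sink → ℝ) = y l • Pi.single l 1 := by
      rw [← Pi.single_smul, smul_eq_mul, mul_one]
    rw [this, map_smul, smul_eq_mul, mul_comm]
  obtain ⟨q, g, hq, hcq⟩ := hf.exists_isOnOff hn
    (fun v => if hv : N.IsSink v then f (Pi.single ⟨v, hv⟩ 1) else 0)
  have hsub : ∀ (y : V → ℝ), ∑ l : N.Sink,
      (if hv : N.IsSink l then f (Pi.single ⟨l, hv⟩ 1) else 0) * y l = f fun l : N.Sink => y l := by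
    intro y
    rw [hfe]
    exact Finset.sum_congr rfl fun l _ => by rw [dif_pos l.2]
  rw [hsub, hsub] at hcq
  have h1 := hu (b • fun l : N.Sink => q l)
    (Set.smul_mem_smul_set (subset_convexHull ℝ _ ⟨q, g, hq, rfl⟩))
  rw [map_smul, smul_eq_mul] at h1
  linarith

/-- A small multiple of any demand can be delivered by a single flow. -/
lemma exists_smul_mem_feasibleRates (hn : 1 ≤ n) {D : N.Sink → ℝ} (hD : ∀ l, 0 ≤ D l) :
    ∃ δ : ℝ, 0 < δ ∧ δ • D ∈ N.feasibleRates n := by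
  have hn0 : 0 < n := by linarith
  obtain ⟨u, hu0, hus, hui⟩ := N.exists_subtreeSum fun v =>
    if hv : N.IsSink v then D ⟨v, hv⟩ else 0
  have hu : ∀ v, 0 ≤ u v := by
    intro v
    induction v using N.child_induction with
    | h v ih =>
      by_cases hv : v = N.source
      · rw [hv, hu0]
      · by_cases hs : N.IsSink v
        · rw [hus v hs, dif_pos hs]
          exact hD _
        · rw [hui v hv hs]
          refine Finset.sum_nonneg fun w hw => ?_
          have hw' : N.parent w = v := by simpa using hw
          exact ih w hw' (N.ne_source_of_parent_eq hv hw')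
  -- `P v` is the head lost between the source and `v` by the flow that delivers `D`
  obtain ⟨P, hP0, hP⟩ := N.exists_rec_parent (0 : ℝ) fun v y => y + N.k v * u v ^ n
  have hPn : ∀ v, 0 ≤ P v := by
    intro v
    induction v using N.parent_induction with
    | h0 => rw [hP0]
    | h v hv ih =>
      rw [hP v hv]
      have := N.k_nonneg v hv
      have := hu v
      positivity
  set Δ := N.sourceHead - N.sinkHead with hΔ
  have hΔ0 : 0 < Δ := sub_pos.2 N.head_lt
  set C := ∑ v, P v + 1 with hC
  have hPC : ∀ v, P v ≤ C := fun v =>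
    (Finset.single_le_sum (fun w _ => hPn w) (Finset.mem_univ v)).trans (by linarith)
  have hC0 : 0 < C := by
    have := Finset.sum_nonneg fun v (_ : v ∈ Finset.univ) => hPn v
    linarith
  have hδn : ((Δ / C) ^ (1 / n)) ^ n = Δ / C := by
    rw [← Real.rpow_mul (by positivity), one_div_mul_cancel hn0.ne', Real.rpow_one]
  have hδ : 0 < (Δ / C) ^ (1 / n) := by positivity
  set δ := (Δ / C) ^ (1 / n)
  have hbound : ∀ v, Δ / C * P v ≤ Δ := fun v => by
    calc Δ / C * P v ≤ Δ / C * C := by gcongr; exact hPC v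
      _ = Δ := div_mul_cancel₀ _ hC0.ne'
  refine ⟨δ, hδ, fun v => δ * u v, fun v => if N.IsSink v then 0 else Δ - Δ / C * P v,
    ⟨?_, fun v => mul_nonneg hδ.le (hu v), fun v hv hs => ?_, ?_, fun v => ?_,
      fun v hv => if_pos hv, fun v hv hs => ?_, fun v hv => ?_⟩, ?_⟩
  · simp [hu0]
  · rw [hui v hv hs, Finset.mul_sum]
  · simp [N.not_isSink_source, hP0, hΔ]
  · split_ifs
    · exact le_rfl
    · exact sub_nonneg.2 (hbound v)
  · simp only [if_neg hs, if_neg (N.not_isSink_parent v)]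
    rw [hP v hv, Real.mul_rpow hδ.le (hu v), hδn]
    ring
  · simp only [if_neg (N.not_isSink_parent v)]
    have := hbound v
    rw [hP v hv.ne_source] at this
    rw [Real.mul_rpow hδ.le (hu v), hδn]
    linarith
  · funext l
    simp [hus l l.2, l.2]

end Compact

section Times

open scoped Pointwise

variable {V : Type*} {N : FlowNetwork V} [Fintype V] {n : ℝ}

lemma mem_feasibleRates_iff (hn : n ≠ 0) {x : N.Sink → ℝ} : x ∈ N.feasibleRates n ↔
    ∃ r ∈ N.continuousConfigs, ∃ Q, N.IsEquilibrium n r Q ∧ x = fun l : N.Sink => Q l := by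
  constructor
  · rintro ⟨Q, h, hf, rfl⟩
    obtain ⟨r, hr, -⟩ := hf.exists_isEquilibrium
    exact ⟨r, Set.mem_univ _, Q, hr, rfl⟩
  · rintro ⟨r, -, Q, he, rfl⟩
    obtain ⟨Q', h, hQ, hf, -⟩ := he.exists_isFeasible hn
    exact ⟨Q', h, hf, funext fun l => (hQ l l.2.ne_source).symm⟩

lemma mem_onOffRates_iff (hn : n ≠ 0) {x : N.Sink → ℝ} : x ∈ N.onOffRates n ↔
    ∃ r ∈ N.onOffConfigs, ∃ Q, N.IsEquilibrium n r Q ∧ x = fun l : N.Sink => Q l := by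
  constructor
  · rintro ⟨Q, h, hf, rfl⟩
    obtain ⟨r, hr, hr'⟩ := hf.toIsFeasible.exists_isEquilibrium
    exact ⟨r, hr' hf, Q, hr, rfl⟩
  · rintro ⟨r, hr, Q, he, rfl⟩
    obtain ⟨Q', h, hQ, -, hf⟩ := he.exists_isFeasible hn
    exact ⟨Q', h, hf hr, funext fun l => (hQ l l.2.ne_source).symm⟩

/-- A demand can be delivered in time `T` exactly when it is `T` times an average of available
rates. -/
lemma mem_operatingTimes_iff {U : Set N.ValveConfig} {X : Set (N.Sink → ℝ)}
    (hX : ∀ x, x ∈ X ↔ ∃ r ∈ U, ∃ Q, N.IsEquilibrium n r Q ∧ x = fun l : N.Sink => Q l)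
    (hne : X.Nonempty) {D : N.Sink → ℝ} {T : ℝ} :
    T ∈ N.operatingTimes n U D ↔ 0 ≤ T ∧ D ∈ T • convexHull ℝ X := by
  constructor
  · rintro ⟨s, r, Q, t, hs, hD, rfl⟩
    have ht : 0 ≤ ∑ i, t i := Finset.sum_nonneg fun i _ => (hs i).2.2
    have hD' : ∑ i, t i • (fun l : N.Sink => Q i l) = D := by
      funext l
      simp [Finset.sum_apply, ← hD l]
    refine ⟨ht, ?_⟩
    rcases ht.eq_or_lt with h0 | h0
    · have hz : ∀ i ∈ Finset.univ, t i = 0 :=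
        (Finset.sum_eq_zero_iff_of_nonneg fun i _ => (hs i).2.2).1 h0.symm
      have : D = 0 := by
        rw [← hD']
        exact Finset.sum_eq_zero fun i hi => by rw [hz i hi, zero_smul]
      obtain ⟨x, hx⟩ := hne
      exact ⟨x, subset_convexHull ℝ X hx, by simp [← h0, this]⟩
    · refine ⟨∑ i, (t i / ∑ i, t i) • (fun l : N.Sink => Q i l), ?_, ?_⟩
      · exact mem_convexHull_of_exists_fintype (fun i => t i / ∑ i, t i)
          (fun i => fun l : N.Sink => Q i l) (fun i => div_nonneg (hs i).2.2 ht)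
          (by rw [← Finset.sum_div, div_self h0.ne'])
          (fun i => (hX _).2 ⟨r i, (hs i).1, Q i, (hs i).2.1, rfl⟩) rfl
      · rw [← hD']
        change (∑ i, t i) • _ = _
        rw [Finset.smul_sum]
        exact Finset.sum_congr rfl fun i _ => by rw [smul_smul, mul_div_cancel₀ _ h0.ne']
  · rintro ⟨hT, y, hy, rfl⟩
    obtain ⟨ι, _, w, z, hw, hw1, hz, rfl⟩ := mem_convexHull_iff_exists_fintype.1 hy
    choose r hr Q hQ hzQ using fun i => (hX _).1 (hz i)
    set e := (Fintype.equivFin ι).symm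
    refine ⟨Fintype.card ι, fun i => r (e i), fun i => Q (e i), fun i => T * w (e i),
      fun i => ⟨hr _, hQ _, mul_nonneg hT (hw _)⟩, fun l => ?_, ?_⟩
    · rw [e.sum_comp fun i => T * w i * Q i l]
      simp only [Pi.smul_apply, Finset.sum_apply, smul_eq_mul, Finset.mul_sum]
      exact Finset.sum_congr rfl fun i _ => by rw [hzQ i]; ring
    · rw [e.sum_comp fun i => T * w i, ← Finset.mul_sum, hw1, mul_one]

/-- The least dilation of a compact set that reaches a given point exists. -/
lemma exists_isLeast_smul {E : Type*} [NormedAddCommGroup E] [NormedSpace ℝ E] {K : Set E}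
    (hK : IsCompact K) {x : E} (hne : {T : ℝ | 0 ≤ T ∧ x ∈ T • K}.Nonempty) :
    ∃ T, IsLeast {T : ℝ | 0 ≤ T ∧ x ∈ T • K} T := by
  obtain ⟨T₀, hT₀, y₀, hy₀, hxy₀⟩ := hne
  have hc : IsCompact ((Set.Icc 0 T₀ ×ˢ K) ∩ {p : ℝ × E | p.1 • p.2 = x}) :=
    (isCompact_Icc.prod hK).inter_right (isClosed_eq (by fun_prop) (by fun_prop))
  obtain ⟨T, hT⟩ := (hc.image continuous_fst).exists_isLeast
    ⟨T₀, (T₀, y₀), ⟨⟨⟨hT₀, le_rfl⟩, hy₀⟩, hxy₀⟩, rfl⟩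
  refine ⟨T, ?_, ?_⟩
  · obtain ⟨⟨T, y⟩, ⟨⟨hT', hy⟩, hxy⟩, rfl⟩ := hT.1
    exact ⟨hT'.1, y, hy, hxy⟩
  · rintro S ⟨hS, y, hy, hxy⟩
    rcases le_total S T₀ with h | h
    · exact hT.2 ⟨(S, y), ⟨⟨⟨hS, h⟩, hy⟩, hxy⟩, rfl⟩
    · exact (hT.2 ⟨(T₀, y₀), ⟨⟨⟨hT₀, le_rfl⟩, hy₀⟩, hxy₀⟩, rfl⟩).trans h

lemma inv_mem_operatingTimes_of_smul_mem (hn : n ≠ 0) {D : N.Sink → ℝ} {δ : ℝ} (hδ : 0 < δ)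
    (h : δ • D ∈ N.feasibleRates n) : δ⁻¹ ∈ N.operatingTimes n N.continuousConfigs D :=
  (mem_operatingTimes_iff (fun _ => mem_feasibleRates_iff hn) ⟨_, h⟩).2
    ⟨inv_nonneg.2 hδ.le, δ • D, subset_convexHull ℝ _ h, inv_smul_smul₀ hδ.ne' D⟩

/-- The minimal times and the bounds on their ratio. -/
theorem isLeast_minTime_and_timeRatio_le (hn : 1 ≤ n) {D : N.Sink → ℝ} (hD : N.IsDemand D) :
    IsLeast (N.operatingTimes n N.onOffConfigs D) (N.minTime n N.onOffConfigs D) ∧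
    IsLeast (N.operatingTimes n N.continuousConfigs D) (N.minTime n N.continuousConfigs D) ∧
    0 < N.minTime n N.continuousConfigs D ∧
    1 ≤ N.timeRatio n D ∧
    N.timeRatio n D ≤ (N.maxDepth : ℝ) ^ (1 - 1 / n) := by
  have hn0 : 0 < n := by linarith
  set b : ℝ := (N.maxDepth : ℝ) ^ (1 - 1 / n) with hb
  have hb0 : 0 ≤ b := Real.rpow_nonneg (Nat.cast_nonneg _) _
  obtain ⟨δ, hδ, hδD⟩ := exists_smul_mem_feasibleRates hn hD.1
  have hsub := feasibleRates_subset (N := N) hn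
  have hon : (N.onOffRates n).Nonempty := by
    obtain ⟨y, hy, -⟩ := hsub hδD
    exact convexHull_nonempty_iff.1 ⟨y, hy⟩
  have hcv : (N.feasibleRates n).Nonempty := ⟨_, hδD⟩
  have hhull : convexHull ℝ (N.feasibleRates n) ⊆ b • convexHull ℝ (N.onOffRates n) :=
    convexHull_min hsub ((convex_convexHull ℝ _).smul b)
  have eon : N.operatingTimes n N.onOffConfigs D =
      {T | 0 ≤ T ∧ D ∈ T • convexHull ℝ (N.onOffRates n)} :=
    Set.ext fun T => mem_operatingTimes_iff (fun x => mem_onOffRates_iff hn0.ne') hon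
  have ecv : N.operatingTimes n N.continuousConfigs D =
      {T | 0 ≤ T ∧ D ∈ T • convexHull ℝ (N.feasibleRates n)} :=
    Set.ext fun T => mem_operatingTimes_iff (fun x => mem_feasibleRates_iff hn0.ne') hcv
  have hslow : ∀ T, T ∈ N.operatingTimes n N.continuousConfigs D →
      T * b ∈ N.operatingTimes n N.onOffConfigs D := by
    intro T hT
    rw [ecv] at hT
    rw [eon]
    obtain ⟨hT0, y, hy, rfl⟩ := hT
    obtain ⟨z, hz, rfl⟩ := hhull hy
    exact ⟨mul_nonneg hT0 hb0, z, hz, mul_smul T b z⟩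
  have hmem : δ⁻¹ ∈ N.operatingTimes n N.continuousConfigs D :=
    inv_mem_operatingTimes_of_smul_mem hn0.ne' hδ hδD
  have Lon : IsLeast (N.operatingTimes n N.onOffConfigs D) (N.minTime n N.onOffConfigs D) := by
    have hne : (N.operatingTimes n N.onOffConfigs D).Nonempty := ⟨_, hslow _ hmem⟩
    rw [eon] at hne
    obtain ⟨T, hT⟩ := exists_isLeast_smul
      (isCompact_convexHull_of_isCompact (isCompact_onOffRates hn0)) hne
    rw [← eon] at hT
    rwa [minTime, hT.csInf_eq]
  have Lcv : IsLeast (N.operatingTimes n N.continuousConfigs D)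
      (N.minTime n N.continuousConfigs D) := by
    have hne : (N.operatingTimes n N.continuousConfigs D).Nonempty := ⟨_, hmem⟩
    rw [ecv] at hne
    obtain ⟨T, hT⟩ := exists_isLeast_smul
      (isCompact_convexHull_of_isCompact (isCompact_feasibleRates hn0)) hne
    rw [← ecv] at hT
    rwa [minTime, hT.csInf_eq]
  have hpos : 0 < N.minTime n N.continuousConfigs D := by
    have h1 := Lcv.1
    rw [ecv] at h1
    refine h1.1.lt_of_ne fun h0 => ?_
    obtain ⟨y, -, hy⟩ := h1.2
    obtain ⟨l, hl⟩ := hD.2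
    rw [← hy, ← h0] at hl
    simp at hl
  refine ⟨Lon, Lcv, hpos, ?_, ?_⟩
  · rw [timeRatio, one_le_div hpos]
    refine Lcv.2 ?_
    obtain ⟨s, r, Q, t, hs, hT⟩ := Lon.1
    exact ⟨s, r, Q, t, fun i => ⟨Set.mem_univ _, (hs i).2⟩, hT⟩
  · rw [timeRatio, div_le_iff₀ hpos, mul_comm]
    exact Lon.2 (hslow _ Lcv.1)

end Times

/-! ### Networks that attain the bound in the limit -/

section Caterpillar

/-- A path `inl 0, …, inl m` from the source to a sink, with a further sink `inr i` hung on each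
`inl i` for `i < m`. The terminal edge of `inr i` is short-circuited, except for `i = 0`, where it
is an edge without demand that only provides a second sink when `m = 1`. The resistances
`M ^ (n * i)` along the path grow so fast that the flows to different sinks lose their heads on
different edges. -/
def caterpillar (n M : ℝ) (hM : 0 < M) (m : ℕ) : FlowNetwork (Fin (m + 1) ⊕ Fin m) where
  source := Sum.inl 0
  parent := Sum.elim (fun i => Sum.inl ⟨i - 1, by omega⟩) (fun i => Sum.inl i.castSucc)
  parent_source := rfl
  reaches_source := by
    have h : ∀ (j : ℕ) (hj : j < m + 1), (Sum.elim (fun i => Sum.inl ⟨i - 1, by omega⟩)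
        (fun i => Sum.inl i.castSucc) : Fin (m + 1) ⊕ Fin m → Fin (m + 1) ⊕ Fin m)^[j]
          (Sum.inl ⟨j, hj⟩) = Sum.inl 0 := by
      intro j
      induction j with
      | zero => exact fun _ => rfl
      | succ j ih => exact fun hj => ih (by omega)
    rintro (i | i)
    · exact ⟨i, h i i.2⟩
    · exact ⟨i + 1, h i (by omega)⟩
  k := Sum.elim (fun i => (M ^ n) ^ (i : ℕ)) (fun i => if (i : ℕ) = 0 then 1 else 0)
  k_nonneg := by
    rintro (i | i) -
    · exact (pow_pos (Real.rpow_pos_of_pos hM n) _).le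
    · simp only [Sum.elim_inr]
      split_ifs <;> norm_num
  sourceHead := 1
  sinkHead := 0
  head_lt := zero_lt_one
  path_pos := by
    rintro (i | i) h
    · exact ⟨0, fun h0 => h (Sum.inl 0) h0.symm, pow_pos (Real.rpow_pos_of_pos hM n) _⟩
    · by_cases hi : (i : ℕ) = 0
      · exact ⟨0, by simp, by simp [hi]⟩
      · refine ⟨1, fun h0 => hi ?_, pow_pos (Real.rpow_pos_of_pos hM n) _⟩
        simpa [Fin.ext_iff] using h0

variable {n M : ℝ} {hM : 0 < M} {m : ℕ}

lemma caterpillar_parent_inl_succ (i : Fin m) :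
    (caterpillar n M hM m).parent (Sum.inl i.succ) = Sum.inl i.castSucc := rfl

lemma caterpillar_parent_inr (i : Fin m) :
    (caterpillar n M hM m).parent (Sum.inr i) = Sum.inl i.castSucc := rfl

lemma caterpillar_isSink_inr (i : Fin m) : (caterpillar n M hM m).IsSink (Sum.inr i) := by
  rintro (j | j) h <;> simp [caterpillar] at h

lemma caterpillar_not_isSink_castSucc (i : Fin m) :
    ¬ (caterpillar n M hM m).IsSink (Sum.inl i.castSucc) := fun h => h (Sum.inr i) rfl

lemma caterpillar_isSink_last (hm : m ≠ 0) :
    (caterpillar n M hM m).IsSink (Sum.inl (Fin.last m)) := by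
  rintro (j | j) h
  · simp only [caterpillar, Sum.elim_inl, Sum.inl.injEq, Fin.ext_iff, Fin.val_last] at h
    omega
  · simp only [caterpillar, Sum.elim_inr, Sum.inl.injEq, Fin.ext_iff, Fin.val_last,
      Fin.val_castSucc] at h
    omega

lemma caterpillar_sum_children {f : Fin (m + 1) ⊕ Fin m → ℝ} (hf : f (Sum.inl 0) = 0) (i : Fin m)
    {_ : DecidablePred fun w => (caterpillar n M hM m).parent w = Sum.inl i.castSucc} :
    ∑ w with (caterpillar n M hM m).parent w = Sum.inl i.castSucc, f w =
      f (Sum.inl i.succ) + f (Sum.inr i) := by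
  rw [Finset.sum_filter, Fintype.sum_sum_type, Fin.sum_univ_succ, hf, ite_self, zero_add]
  simp only [caterpillar_parent_inl_succ, caterpillar_parent_inr, Sum.inl.injEq,
    Fin.castSucc_inj]
  simp

lemma caterpillar_depth_inl (i : Fin (m + 1)) :
    (caterpillar n M hM m).depth (Sum.inl i) = i := by
  induction i using Fin.induction with
  | zero => exact depth_source _
  | succ i ih =>
    rw [depth_eq_succ _ (by simp [caterpillar]), caterpillar_parent_inl_succ, ih]
    simp

lemma caterpillar_maxDepth : (caterpillar n M hM m).maxDepth = m := by
  apply le_antisymm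
  · refine Finset.sup_le ?_
    rintro (i | i) -
    · rw [caterpillar_depth_inl]
      omega
    · rw [depth_eq_succ _ (by simp [caterpillar]), caterpillar_parent_inr, caterpillar_depth_inl,
        Fin.val_castSucc]
      omega
  · have := (caterpillar n M hM m).depth_le_maxDepth (Sum.inl (Fin.last m))
    rwa [caterpillar_depth_inl] at this

lemma caterpillar_two_le_card_sink (hm : m ≠ 0) : 2 ≤ Nat.card (caterpillar n M hM m).Sink := by
  have : Nontrivial (caterpillar n M hM m).Sink :=
    ⟨⟨⟨_, caterpillar_isSink_last hm⟩, ⟨_, caterpillar_isSink_inr ⟨0, Nat.pos_of_ne_zero hm⟩⟩,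
      by simp⟩⟩
  exact Finite.one_lt_card

/-- The quantity `x ^ i` for the sink hung at the `i`-th vertex of the path (or at its end), but
nothing for the sink at the source. It serves as the demand for `x = M⁻¹`, and for `x = M` as the
weights that bound what ON/OFF valves deliver. -/
def caterpillarWeight (m : ℕ) (x : ℝ) : Fin (m + 1) ⊕ Fin m → ℝ :=
  Sum.elim (fun i => x ^ (i : ℕ)) (fun i => if (i : ℕ) = 0 then 0 else x ^ (i : ℕ))

/-- An open short-circuited sink takes the whole head, so that nothing flows beyond it: hence only
one sink on the path is served at a time. -/
lemma caterpillar_onOff_sum_le (hn : 0 < n) (hm : m ≠ 0) {Q h : Fin (m + 1) ⊕ Fin m → ℝ}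
    (hf : (caterpillar n M hM m).IsOnOff n (caterpillar n M hM m).k 1 Q h) :
    ∑ l : (caterpillar n M hM m).Sink, caterpillarWeight m M l * Q l ≤ 1 := by
  set N := caterpillar n M hM m with hN
  obtain ⟨u, hu0, hus, hu⟩ := N.exists_subtreeSum fun v => caterpillarWeight m M v * Q v
  have hQ0 : Q (Sum.inl 0) = 0 := hf.flow_source
  have hu00 : u (Sum.inl 0) = 0 := hu0
  have hpath : ∀ i : Fin (m + 1), i ≠ 0 → M ^ (i : ℕ) * Q (Sum.inl i) ≤ 1 := by
    intro i hi
    have hi' : (Sum.inl i : Fin (m + 1) ⊕ Fin m) ≠ N.source := by simpa [hN, caterpillar] using hi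
    have h1 := (hf.drop_le hi').trans (hf.toIsFeasible.head_le N.k_nonneg _)
    have h2 : N.k (Sum.inl i) = (M ^ (i : ℕ)) ^ n := by
      change (M ^ n) ^ (i : ℕ) = _
      rw [← Real.rpow_natCast, ← Real.rpow_natCast, ← Real.rpow_mul hM.le, ← Real.rpow_mul hM.le,
        mul_comm]
    have hMi : 0 ≤ M ^ (i : ℕ) := (pow_pos hM _).le
    rw [h2, ← Real.mul_rpow hMi (hf.flow_nonneg _)] at h1
    by_contra! h3
    exact absurd h1 (not_le.2 (Real.one_lt_rpow h3 hn))
  have hleaf : ∀ i : Fin m, u (Sum.inr i) ≤ 1 ∧ (Q (Sum.inr i) = 0 → u (Sum.inr i) = 0) := by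
    intro i
    rw [hus _ (caterpillar_isSink_inr i)]
    refine ⟨?_, fun h0 => by rw [h0, mul_zero]⟩
    by_cases hi : (i : ℕ) = 0
    · simp [caterpillarWeight, hi]
    · have hi' : i.castSucc ≠ 0 := fun h0 => hi (by simpa [Fin.ext_iff] using h0)
      have h1 : Q (Sum.inr i) ≤ Q (Sum.inl i.castSucc) :=
        hf.flow_le_parent (v := Sum.inr i) (by simpa [hN, caterpillar] using hi')
      have h2 := mul_le_mul_of_nonneg_left h1 (pow_pos hM (i : ℕ)).le
      simpa [caterpillarWeight, hi] using h2.trans (hpath i.castSucc hi')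
  -- from the end of the path upwards: an open sink at `i` carries everything that passes `i`
  have hspine : ∀ i : Fin (m + 1), i ≠ 0 →
      u (Sum.inl i) ≤ 1 ∧ (Q (Sum.inl i) = 0 → u (Sum.inl i) = 0) := by
    intro i
    induction i using Fin.reverseInduction with
    | last =>
      intro h0
      rw [hus _ (caterpillar_isSink_last hm)]
      exact ⟨by simpa [caterpillarWeight] using hpath _ h0, fun h1 => by rw [h1, mul_zero]⟩
    | cast i ih =>
      intro h0
      obtain ⟨ih1, ih2⟩ := ih (Fin.succ_ne_zero i)
      obtain ⟨l1, l2⟩ := hleaf i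
      have hsrc : (Sum.inl i.castSucc : Fin (m + 1) ⊕ Fin m) ≠ N.source := by
        simpa [hN, caterpillar] using h0
      have hi : (i : ℕ) ≠ 0 := fun h => h0 (by simpa [Fin.ext_iff] using h)
      have hns := caterpillar_not_isSink_castSucc (n := n) (hM := hM) i
      have e1 : u (Sum.inl i.castSucc) = u (Sum.inl i.succ) + u (Sum.inr i) :=
        (hu _ hsrc hns).trans (caterpillar_sum_children hu00 i)
      have e2 : Q (Sum.inl i.castSucc) = Q (Sum.inl i.succ) + Q (Sum.inr i) :=
        (hf.conserve _ hsrc hns).trans (caterpillar_sum_children hQ0 i)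
      have q1 := hf.flow_nonneg (Sum.inl i.succ)
      have q2 := hf.flow_nonneg (Sum.inr i)
      rcases hf.on_or_off _ (caterpillar_isSink_inr i) with hoff | hon
      · rw [e1, e2, l2 hoff, hoff, add_zero, add_zero]
        exact ⟨ih1, ih2⟩
      · have hk : N.k (Sum.inr i) = 0 := if_neg hi
        have hh : h (Sum.inl i.castSucc) = 0 := by
          have : N.k (Sum.inr i) * Q (Sum.inr i) ^ n = h (Sum.inl i.castSucc) := hon
          rw [← this, hk, zero_mul]
        have hnext : Q (Sum.inl i.succ) = 0 := by
          have h1 : N.k (Sum.inl i.succ) * Q (Sum.inl i.succ) ^ n ≤ 0 :=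
            (hf.drop_le (v := Sum.inl i.succ) (by simp [hN, caterpillar])).trans hh.le
          have h2 : 0 < N.k (Sum.inl i.succ) := pow_pos (Real.rpow_pos_of_pos hM n) _
          by_contra h3
          have h4 := Real.rpow_pos_of_pos (q1.lt_of_ne' h3) n
          exact absurd h1 (not_le.2 (mul_pos h2 h4))
        rw [e1, e2, ih2 hnext, hnext, zero_add, zero_add]
        exact ⟨l1, l2⟩
  have hsum := N.sum_children_source hu0 hu
  rw [← Finset.sum_congr rfl fun (l : N.Sink) _ => hus l l.2, ← hsum]
  set i₀ : Fin m := ⟨0, Nat.pos_of_ne_zero hm⟩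
  refine (caterpillar_sum_children hu00 i₀).le.trans ?_
  have h2 : u (Sum.inr i₀) = 0 := by
    rw [hus _ (caterpillar_isSink_inr i₀)]
    simp [caterpillarWeight, i₀]
  rw [h2, add_zero]
  exact (hspine _ (Fin.succ_ne_zero i₀)).1

lemma caterpillar_sum_weight_mul (hm : m ≠ 0) :
    ∑ l : (caterpillar n M hM m).Sink, caterpillarWeight m M l * caterpillarWeight m M⁻¹ l = m := by
  set N := caterpillar n M hM m with hN
  -- the number of sinks with a demand below each vertex
  set u : Fin (m + 1) ⊕ Fin m → ℝ := Sum.elim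
    (fun i => if i = 0 then 0 else (m : ℝ) + 1 - (i : ℕ))
    (fun i => if (i : ℕ) = 0 then 0 else 1) with hu
  have hu0 : u (Sum.inl 0) = 0 := by simp [hu]
  have hsum := N.sum_children_source (u := u) hu0 (by
    rintro (i | i) hi hs
    · induction i using Fin.lastCases with
      | last => exact absurd (caterpillar_isSink_last hm) hs
      | cast i =>
        refine Eq.trans ?_ (caterpillar_sum_children hu0 i).symm
        have h0 : i.castSucc ≠ 0 := by simpa [hN, caterpillar] using hi
        have h1 : (i : ℕ) ≠ 0 := fun h => h0 (by simpa [Fin.ext_iff] using h)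
        simp only [hu, Sum.elim_inl, Sum.elim_inr, if_neg h0, if_neg h1,
          if_neg (Fin.succ_ne_zero i), Fin.val_castSucc, Fin.val_succ]
        push_cast
        ring
    · exact absurd (caterpillar_isSink_inr i) hs)
  set i₀ : Fin m := ⟨0, Nat.pos_of_ne_zero hm⟩
  have h1 := hsum.symm.trans (caterpillar_sum_children hu0 i₀)
  have h2 : u (Sum.inl i₀.succ) + u (Sum.inr i₀) = m := by
    simp [hu, i₀]
  rw [← h2, ← h1]
  refine Finset.sum_congr rfl ?_
  rintro ⟨i | i, hs⟩ -
  · induction i using Fin.lastCases with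
    | last =>
      have : Fin.last m ≠ 0 := by simpa [Fin.ext_iff] using hm
      simp [caterpillarWeight, hu, this, hM.ne', hm]
    | cast i => exact absurd hs (caterpillar_not_isSink_castSucc i)
  · by_cases hi : (i : ℕ) = 0
    · simp [caterpillarWeight, hu, hi]
    · simp [caterpillarWeight, hu, hi, hM.ne']

lemma caterpillar_isDemand (hm : m ≠ 0) :
    (caterpillar n M hM m).IsDemand fun l => caterpillarWeight m M⁻¹ l := by
  have hpos : ∀ i : ℕ, 0 < M⁻¹ ^ i := fun i => pow_pos (inv_pos.2 hM) i
  refine ⟨?_, ⟨_, caterpillar_isSink_last hm⟩, hpos _⟩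
  rintro ⟨i | i, -⟩
  · exact (hpos _).le
  · simp only [caterpillarWeight, Sum.elim_inr]
    split_ifs
    · exact le_rfl
    · exact (hpos _).le

/-- Continuous valves serve all sinks of the caterpillar at once, spending a share of at most
`1 / m` of the head on each edge of the path. -/
lemma caterpillar_mem_feasibleRates (hn : 1 ≤ n) (hm : m ≠ 0) (hM1 : 1 < M) :
    ((1 - M⁻¹) / (m : ℝ) ^ (1 / n)) •
      (fun l : (caterpillar n M hM m).Sink => caterpillarWeight m M⁻¹ l) ∈
        (caterpillar n M hM m).feasibleRates n := by
  set N := caterpillar n M hM m with hN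
  have hn0 : 0 < n := by linarith
  have hm0 : (0 : ℝ) < m := Nat.cast_pos.2 (Nat.pos_of_ne_zero hm)
  set x := M⁻¹ with hx
  have hx0 : 0 < x := inv_pos.2 hM
  have hx1 : x < 1 := inv_lt_one_of_one_lt₀ hM1
  have hxM : M * x = 1 := mul_inv_cancel₀ hM.ne'
  set τ := (m : ℝ) ^ (1 / n) with hτ
  have hτ0 : 0 < τ := Real.rpow_pos_of_pos hm0 _
  have hτn : τ ^ n = m := by
    rw [hτ, ← Real.rpow_mul hm0.le, one_div_mul_cancel hn0.ne', Real.rpow_one]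
  -- the flow along the path is the sum of a geometric progression
  set s : ℕ → ℝ := fun i => (x ^ i - x ^ (m + 1)) / τ with hs
  have hs0 : ∀ i ≤ m + 1, 0 ≤ s i := fun i hi =>
    div_nonneg (sub_nonneg.2 (pow_le_pow_of_le_one hx0.le hx1.le hi)) hτ0.le
  set loss : ℕ → ℝ := fun i => (M ^ n) ^ i * s i ^ n with hloss
  have hloss_le : ∀ i ≤ m + 1, loss i ≤ 1 / m := by
    intro i hi
    have h2 : (M ^ n) ^ i = (M ^ i) ^ n := by
      rw [← Real.rpow_natCast, ← Real.rpow_natCast, ← Real.rpow_mul hM.le, ← Real.rpow_mul hM.le,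
        mul_comm]
    have hMi : 0 < M ^ i := pow_pos hM i
    rw [hloss]
    dsimp only
    rw [h2, ← Real.mul_rpow hMi.le (hs0 i hi), ← hτn, ← Real.one_rpow n,
      ← Real.div_rpow zero_le_one hτ0.le]
    refine Real.rpow_le_rpow (mul_nonneg hMi.le (hs0 i hi)) ?_ hn0.le
    rw [hs]
    dsimp only
    rw [mul_div_assoc']
    refine div_le_div_of_nonneg_right ?_ hτ0.le
    rw [mul_sub, ← mul_pow, hxM, one_pow]
    have : 0 ≤ M ^ i * x ^ (m + 1) := by positivity
    linarith
  set head : ℕ → ℝ := fun i => 1 - ∑ j ∈ Finset.range i, loss (j + 1) with hhead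
  have hhead_ge : ∀ i ≤ m, 1 - i / m ≤ head i := by
    intro i hi
    have : ∑ j ∈ Finset.range i, loss (j + 1) ≤ ∑ j ∈ Finset.range i, (1 / m : ℝ) :=
      Finset.sum_le_sum fun j hj => hloss_le _ (by have := Finset.mem_range.1 hj; omega)
    rw [Finset.sum_const, Finset.card_range, nsmul_eq_mul, mul_one_div] at this
    rw [hhead]
    dsimp only
    linarith
  have hhead0 : ∀ i ≤ m, 0 ≤ head i := fun i hi => by
    have h1 := hhead_ge i hi
    have h2 : (i : ℝ) / m ≤ 1 := (div_le_one hm0).2 (Nat.cast_le.2 hi)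
    linarith
  set Q : Fin (m + 1) ⊕ Fin m → ℝ := Sum.elim
    (fun i => if (i : ℕ) = 0 then 0 else s i)
    (fun i => (1 - x) / τ * caterpillarWeight m x (Sum.inr i)) with hQ
  have hQ0 : Q (Sum.inl 0) = 0 := by simp [hQ]
  refine ⟨Q, Sum.elim (fun i => if i = Fin.last m then 0 else head i) (fun _ => 0),
    ⟨hQ0, ?_, ?_, ?_, ?_, ?_, ?_, ?_⟩, ?_⟩
  · rintro (i | i)
    · simp only [hQ, Sum.elim_inl]
      split_ifs
      · exact le_rfl
      · exact hs0 _ (by omega)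
    · have h1 : 0 ≤ 1 - x := by linarith
      simp only [hQ, Sum.elim_inr, caterpillarWeight]
      split_ifs <;> positivity
  · rintro (i | i) hi hsk
    · induction i using Fin.lastCases with
      | last => exact absurd (caterpillar_isSink_last hm) hsk
      | cast i =>
        refine Eq.trans ?_ (caterpillar_sum_children hQ0 i).symm
        have h0 : i.castSucc ≠ 0 := by simpa [hN, caterpillar] using hi
        have h1 : (i : ℕ) ≠ 0 := fun h => h0 (by simpa [Fin.ext_iff] using h)
        simp only [hQ, Sum.elim_inl, Sum.elim_inr, caterpillarWeight, Fin.val_castSucc,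
          Fin.val_succ, if_neg h1, if_neg (Nat.succ_ne_zero _), hs]
        ring
    · exact absurd (caterpillar_isSink_inr i) hsk
  · have : (0 : Fin (m + 1)) ≠ Fin.last m := by simpa [Fin.ext_iff] using hm.symm
    change (if (0 : Fin (m + 1)) = Fin.last m then 0 else head (0 : Fin (m + 1))) = (1 : ℝ) - 0
    simp [this, hhead]
  · rintro (i | i)
    · simp only [Sum.elim_inl]
      split_ifs
      · exact le_rfl
      · exact hhead0 _ (by omega)
    · exact le_rfl
  · rintro (i | i) hsk
    · induction i using Fin.lastCases with
      | last => simp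
      | cast i => exact absurd hsk (caterpillar_not_isSink_castSucc i)
    · rfl
  · rintro (i | i) hi hsk
    · have h1 : i ≠ Fin.last m := by
        rintro rfl
        exact hsk (caterpillar_isSink_last hm)
      induction i using Fin.cases with
      | zero => exact absurd rfl hi
      | succ i =>
        rw [hN, caterpillar_parent_inl_succ, Sum.elim_inl, Sum.elim_inl,
          if_neg (Fin.castSucc_lt_last i).ne, if_neg h1]
        change head i - head (i + 1) = (M ^ n) ^ ((i : ℕ) + 1) * s (i + 1) ^ n
        rw [hhead]
        dsimp only
        rw [Finset.sum_range_succ]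
        simp only [hloss]
        ring
    · exact absurd (caterpillar_isSink_inr i) hsk
  · rintro (i | i) hsk
    · induction i using Fin.lastCases with
      | last =>
        obtain ⟨p, rfl⟩ := Nat.exists_eq_succ_of_ne_zero hm
        have h1 : loss (p + 1) ≤ head p := by
          have h2 := hloss_le (p + 1) (by omega)
          have h3 := hhead_ge p (by omega)
          have h4 : (1 : ℝ) - p / (p + 1 : ℕ) = 1 / (p + 1 : ℕ) := by
            push_cast
            field_simp
            ring
          linarith
        have h2 := (Fin.castSucc_lt_last (Fin.last p)).ne
        change (M ^ n) ^ (p + 1) * s (p + 1) ^ n ≤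
          if (Fin.last p).castSucc = Fin.last (p + 1) then 0 else head p
        rwa [if_neg h2]
      | cast i => exact absurd hsk (caterpillar_not_isSink_castSucc i)
    · rw [hN, caterpillar_parent_inr, Sum.elim_inl, if_neg (Fin.castSucc_lt_last i).ne]
      refine le_trans (le_of_eq ?_) (hhead0 i i.2.le)
      change (if (i : ℕ) = 0 then (1 : ℝ) else 0) * Q (Sum.inr i) ^ n = 0
      by_cases hi : (i : ℕ) = 0
      · simp [hQ, caterpillarWeight, hi, Real.zero_rpow hn0.ne']
      · simp [hi]
  · funext ⟨v, hv⟩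
    rcases v with i | i
    · induction i using Fin.lastCases with
      | last =>
        simp only [hQ, caterpillarWeight, Pi.smul_apply, Sum.elim_inl, Fin.val_last, if_neg hm, hs,
          smul_eq_mul]
        ring
      | cast i => exact absurd hv (caterpillar_not_isSink_castSucc i)
    · rfl

/-- The weighted demand is `m`, of which ON/OFF valves deliver at most `1` per unit of time;
continuous valves finish within `m ^ (1 / n) / (1 - M⁻¹)`. -/
lemma caterpillar_le_timeRatio (hn : 1 ≤ n) (hm : m ≠ 0) (hM1 : 1 < M) :
    (m : ℝ) ^ (1 - 1 / n) * (1 - M⁻¹) ≤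
      (caterpillar n M hM m).timeRatio n fun l => caterpillarWeight m M⁻¹ l := by
  set N := caterpillar n M hM m with hN
  have hn0 : 0 < n := by linarith
  have hm0 : (0 : ℝ) < m := Nat.cast_pos.2 (Nat.pos_of_ne_zero hm)
  obtain ⟨Lon, Lcv, hpos, -, -⟩ :=
    isLeast_minTime_and_timeRatio_le hn (caterpillar_isDemand (n := n) (hM := hM) hm)
  have hx1 : 0 < 1 - M⁻¹ := sub_pos.2 (inv_lt_one_of_one_lt₀ hM1)
  have hτ : 0 < (m : ℝ) ^ (1 / n) := Real.rpow_pos_of_pos hm0 _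
  have h1 := Lcv.2 (inv_mem_operatingTimes_of_smul_mem hn0.ne' (div_pos hx1 hτ)
    (caterpillar_mem_feasibleRates hn hm hM1))
  have h2 : (m : ℝ) ≤ N.minTime n N.onOffConfigs fun l => caterpillarWeight m M⁻¹ l := by
    obtain ⟨s, r, Q, t, hs, hD, hT⟩ := Lon.1
    rw [← hN] at hT
    have hsum : ∑ l : N.Sink, caterpillarWeight m M l * caterpillarWeight m M⁻¹ l =
        ∑ i, ∑ l : N.Sink, caterpillarWeight m M l * (t i * Q i l) := by
      rw [Finset.sum_comm]
      exact Finset.sum_congr rfl fun l _ => by rw [← Finset.mul_sum]; exact congrArg _ (hD l).symm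
    rw [← hT, ← caterpillar_sum_weight_mul (n := n) (hM := hM) hm, hsum]
    refine Finset.sum_le_sum fun i _ => ?_
    obtain ⟨Q', h, hQ, -, hf⟩ := (hs i).2.1.exists_isFeasible hn0.ne'
    have hf' := hf (hs i).1
    have hΔ : N.sourceHead - N.sinkHead = 1 := sub_zero 1
    rw [hΔ] at hf'
    have h3 := mul_le_mul_of_nonneg_left (caterpillar_onOff_sum_le hn0 hm hf') (hs i).2.2
    rw [mul_one, Finset.mul_sum] at h3
    refine le_trans (le_of_eq ?_) h3
    refine Finset.sum_congr rfl fun l _ => ?_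
    rw [hQ l l.2.ne_source]
    ring
  rw [timeRatio, le_div_iff₀ hpos]
  refine le_trans ?_ h2
  calc (m : ℝ) ^ (1 - 1 / n) * (1 - M⁻¹) * N.minTime n N.continuousConfigs _
      ≤ (m : ℝ) ^ (1 - 1 / n) * (1 - M⁻¹) * ((1 - M⁻¹) / (m : ℝ) ^ (1 / n))⁻¹ := by gcongr
    _ = m := by
      rw [Real.rpow_sub hm0, Real.rpow_one]
      generalize 1 - M⁻¹ = y at hx1
      field_simp

end Caterpillar

end FlowNetwork

end

theorem mainTheorem1 (n : ℝ) (hn : 1 ≤ n) :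
    (∀ (V : Type*) [Fintype V] (N : FlowNetwork V) (D : N.Sink → ℝ), N.IsDemand D →
      IsLeast (N.operatingTimes n N.onOffConfigs D) (N.minTime n N.onOffConfigs D) ∧
      IsLeast (N.operatingTimes n N.continuousConfigs D) (N.minTime n N.continuousConfigs D) ∧
      0 < N.minTime n N.continuousConfigs D ∧
      1 ≤ N.timeRatio n D ∧
      N.timeRatio n D ≤ (N.maxDepth : ℝ) ^ (1 - 1 / n)) ∧
    (∀ m : ℕ, 1 ≤ m →
      IsLUB {R : ℝ | ∃ (V : Type) (_ : Fintype V) (N : FlowNetwork V) (D : N.Sink → ℝ),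
          2 ≤ Nat.card N.Sink ∧ N.maxDepth = m ∧ N.IsDemand D ∧ R = N.timeRatio n D}
        ((m : ℝ) ^ (1 - 1 / n))) := by
  refine ⟨fun V _ N D hD => FlowNetwork.isLeast_minTime_and_timeRatio_le hn hD,
    fun m hm => ⟨?_, fun b hb => ?_⟩⟩
  · rintro R ⟨V, _, N, D, -, rfl, hD, rfl⟩
    exact (FlowNetwork.isLeast_minTime_and_timeRatio_le hn hD).2.2.2.2
  · have hm0 : m ≠ 0 := by omega
    have h1 : Filter.Tendsto (fun M : ℝ => (m : ℝ) ^ (1 - 1 / n) * (1 - M⁻¹)) Filter.atTop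
        (nhds ((m : ℝ) ^ (1 - 1 / n) * (1 - 0))) :=
      (tendsto_inv_atTop_zero.const_sub 1).const_mul _
    rw [sub_zero, mul_one] at h1
    refine le_of_tendsto h1 ?_
    filter_upwards [Filter.eventually_gt_atTop (1 : ℝ)] with M hM1
    have hM : 0 < M := zero_lt_one.trans hM1
    exact (FlowNetwork.caterpillar_le_timeRatio (hM := hM) hn hm0 hM1).trans
      (hb ⟨_, inferInstance, FlowNetwork.caterpillar n M hM m, _,
        FlowNetwork.caterpillar_two_le_card_sink hm0, FlowNetwork.caterpillar_maxDepth,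
        FlowNetwork.caterpillar_isDemand hm0, rfl⟩)
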